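/- **Network.** Consider a slotted-time network of $M$ (virtual) queues with queue-length vector $X_t\in\mathbb N^M$ evolving as $$X_{t+1}=X_t+A_t-D_t(I-R),$$ where vectors are row vectors, $A_t\in\mathbb N^M$ are the external arrivals, $D_t$ the departures, and $R\in\{0,1\}^{M\times M}$ is the routing matrix ($r^{(m,p)}=1$ iff customers leaving queue $m$ enter queue $p$; every row has at most one $1$, and routes have no cycles). *Service constraints.* $S^D_t$ is an irreducible Markov chain on a finite set with stationary distribution $\pi^D$. To each state $s$ there correspond a compact convex set $\mathcal D(s)\subset\mathbb R_+^M$ and a set of feasible vectors contained in $\mathcal D(s)$, which contains all extreme points of $\mathcal D(s)$ and contains, with every $D$, the componentwise minimum $\min(D,x)$ for all $x\in\mathbb N^M$. Let $\mathcal D_{\mathcal F}(s,x)$ be the set of feasible vectors $D$ for the state $s$ with $D\le x$. *Arrivals.* $S^A_t$ is an irreducible Markov chain on a finite set with stationary distribution $\pi^A$. Given the past, $A_t$ has a law that depends only on $S^A_t$ and is supported in a fixed bounded set (Markov-modulated Bernoulli arrivals). Given the past, $A_t$, $S^A_{t+1}$, $S^D_{t+1}$ and the choice of $D_t$ are independent.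 Let $\Lambda$ be the mean of $A_t$ when $S^A_t\sim\pi^A$, and $W=\Lambda(I-R)^{-1}$. The arrivals are *admissible* if $W$ lies in the interior, relative to $\mathbb R_+^M$, of $\{\sum_s\pi^D_sD(s): D(s)\in\mathcal D(s)\ \forall s\}$. *Policy.* The $\nabla G$-max-scalar policy chooses $$D_t\in\operatorname*{arg\,max}_{D\in\mathcal D_{\mathcal F}(S^D_t,X_t)}\langle\nabla G(X_t)(I-R)^T\cdot D\rangle ,$$ by any stationary rule, possibly randomized, that depends only on $(X_t,S^A_t,S^D_t)$. **Theorem.** Let $G\in C^\infty(\mathbb R_+^M\to\mathbb R)$ satisfy the following conditions, where $\|X\|\to\infty$ means $X\in\mathbb R_+^M$, $\|X\|\to\infty$, uniformly in the direction of $X$, and $\partial^hG$ is the $h$-th derivative. 1. $G(X)/\|X\|\to\infty$ as $\|X\|\to\infty$. 2. For some $h_0\in\mathbb N$, $\limsup_{\|X\|\to\infty}\|(\partial^{h_0}G)(X)\|<\infty$, and for all $h<h_0$, $\|(\partial^{h+1}G)(X)\|=o(\|(\partial^{h}G)(X)\|)$ as $\|X\|\to\infty$. 3. $\langle\nabla G(X)(I-R)^T\cdot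 D\rangle\le0$ for all $X\in\mathbb R_+^M$ and all $D\ge0$ with $\langle X\cdot D\rangle=0$. 4. There is $c>0$ such that for all $X\in\mathbb R_+^M$ with $\|X\|$ large enough, some $D\in[0,1]^M$ satisfies $\langle\nabla G(X)(I-R)^T\cdot D\rangle\ge c\,\|\nabla G(X)\|$. Suppose that the arrivals are admissible, that the $\nabla G$-max-scalar policy is employed, and that $\mathbb E|G(X_0)|<\infty$ (for instance, $X_0$ deterministic). Then the network is $\|\nabla G(X)\|$-stable: $$\limsup_{t\to\infty}\mathbb E\big[\|\nabla G(X_t)\|\big]<\infty .$$ -/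

import Mathlib

open Filter Topology MeasureTheory Asymptotics


noncomputable section

/-! ### Vectors -/

/-- The closed nonnegative orthant `ℝ₊^M`. -/
def orthant (M : ℕ) : Set (EuclideanSpace ℝ (Fin M)) := {x | ∀ m, 0 ≤ x m}

/-- A vector of customer counts, seen as a Euclidean vector. -/
def countVec {M : ℕ} (x : Fin M → ℕ) : EuclideanSpace ℝ (Fin M) :=
  WithLp.toLp 2 (fun m => (x m : ℝ))

/-- The filter `‖X‖ → ∞`, `X ∈ ℝ₊^M`. -/
def atInftyOrthant (M : ℕ) : Filter (EuclideanSpace ℝ (Fin M)) :=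
  Bornology.cobounded (EuclideanSpace ℝ (Fin M)) ⊓ 𝓟 (orthant M)

/-- The gradient of `G : ℝ₊^M → ℝ` (one-sided on the boundary of the orthant). -/
def grad {M : ℕ} (G : EuclideanSpace ℝ (Fin M) → ℝ) (x : EuclideanSpace ℝ (Fin M)) :
    EuclideanSpace ℝ (Fin M) :=
  gradientWithin G (orthant M) x

/-- The scalar product `⟨∇G(x) (I - R)ᵀ · D⟩` of the vector of pressures with `D`. -/
def pressureProd {M : ℕ} (R : Matrix (Fin M) (Fin M) ℝ) (G : EuclideanSpace ℝ (Fin M) → ℝ)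
    (x : EuclideanSpace ℝ (Fin M)) (D : Fin M → ℝ) : ℝ :=
  dotProduct (Matrix.vecMul (WithLp.ofLp (grad G x)) (Matrix.transpose (1 - R))) D

/-! ### The network -/

/-- A routing matrix: `R m p = 1` if the customers leaving queue `m` enter queue `p`, and
`R m p = 0` otherwise. There is no forking, and routes are simple paths, so that no directed
cycle of queues exists, which is to say that `R` is nilpotent. -/
structure IsRoutingMatrix {M : ℕ} (R : Matrix (Fin M) (Fin M) ℝ) : Prop where
  zero_or_one : ∀ m p, R m p = 0 ∨ R m p = 1
  no_fork : ∀ m p q, R m p = 1 → R m q = 1 → p = q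
  acyclic : IsNilpotent R

/-- Service constraints driven by an environment state `s`: `region s` is the compact convex set
`𝒟(s)`, and `feasible s` is the set of those vectors of `𝒟(s)` that satisfy all constraints
(integrality, for instance). All vertices of `𝒟(s)` are feasible, and the componentwise minimum
of a feasible vector and a vector of queue lengths is feasible. -/
structure IsServiceModel {M : ℕ} {SD : Type*} (region feasible : SD → Set (Fin M → ℝ)) :
    Prop where
  compact : ∀ s, IsCompact (region s)
  convex : ∀ s, Convex ℝ (region s)
  nonneg : ∀ s, ∀ D ∈ region s, 0 ≤ D
  feasible_subset : ∀ s, feasible s ⊆ region s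
  vertices_feasible : ∀ s, Set.extremePoints ℝ (region s) ⊆ feasible s
  min_feasible : ∀ s, ∀ D ∈ feasible s, ∀ x : Fin M → ℕ,
    (fun m => min (D m) (x m : ℝ)) ∈ feasible s

/-- The set `𝒟_F(s, x)` of the feasible departure vectors `D ≤ x`. -/
def feasibleAt {M : ℕ} {SD : Type*} (feasible : SD → Set (Fin M → ℝ)) (s : SD)
    (x : Fin M → ℕ) : Set (Fin M → ℝ) :=
  {D | D ∈ feasible s ∧ ∀ m, D m ≤ (x m : ℝ)}

/-- `D` is an `argmax` of `⟨∇G(x) (I - R)ᵀ · D⟩` over `𝒟_F(s, x)`. -/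
def IsMaxScalarChoice {M : ℕ} {SD : Type*} (R : Matrix (Fin M) (Fin M) ℝ)
    (G : EuclideanSpace ℝ (Fin M) → ℝ) (feasible : SD → Set (Fin M → ℝ)) (s : SD)
    (x : Fin M → ℕ) (D : Fin M → ℝ) : Prop :=
  D ∈ feasibleAt feasible s x ∧
    IsMaxOn (pressureProd R G (countVec x)) (feasibleAt feasible s x) D

/-! ### The modulating Markov chains and the admissible arrival rates -/

/-- Irreducibility of a Markov chain given by its transition probabilities. -/
def IsIrreducibleChain {S : Type*} (P : S → PMF S) : Prop :=
  ∀ s s', Relation.ReflTransGen (fun u v => v ∈ (P u).support) s s'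

/-- `π` is a stationary distribution of the chain `P`. -/
def IsStationaryFor {S : Type*} (P : S → PMF S) (π : PMF S) : Prop := π.bind P = π

/-- The average arrival vector `Λ`, when `arr s` is the law of the arrivals of one slot in the
modulating state `s` and `πA` is the steady state of the modulating chain. -/
def arrivalRate {M : ℕ} {SA : Type*} [Fintype SA] (πA : PMF SA) (arr : SA → PMF (Fin M → ℕ)) :
    Fin M → ℝ :=
  fun m => ∑ s, (πA s).toReal * ∑' a : Fin M → ℕ, (arr s a).toReal * (a m : ℝ)

/-- The average workload vector `W = Λ (I - R)⁻¹`. -/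
def workload {M : ℕ} (R : Matrix (Fin M) (Fin M) ℝ) (L : Fin M → ℝ) : Fin M → ℝ :=
  Matrix.vecMul L (1 - R)⁻¹

/-- The workloads `∑ₛ π(s) D(s)` with `D(s) ∈ 𝒟(s)` for every environment state `s`. -/
def sustainableWorkloads {M : ℕ} {SD : Type*} [Fintype SD] (πD : PMF SD)
    (region : SD → Set (Fin M → ℝ)) : Set (Fin M → ℝ) :=
  {W | ∃ D : SD → Fin M → ℝ, (∀ s, D s ∈ region s) ∧ W = ∑ s, (πD s).toReal • D s}

/-- Admissibility of the rate `L`: its workload lies in the interior, relative to `ℝ₊^M`, of the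
set of sustainable workloads. -/
def IsAdmissibleRate {M : ℕ} {SD : Type*} [Fintype SD] (R : Matrix (Fin M) (Fin M) ℝ)
    (πD : PMF SD) (region : SD → Set (Fin M → ℝ)) (L : Fin M → ℝ) : Prop :=
  0 ≤ workload R L ∧
    sustainableWorkloads πD region ∈ 𝓝[Set.Ici 0] (workload R L)

/-! ### The controlled system of queues -/

/-- The system of queues under a stationary, possibly randomized, policy `pol`.
`X`, `A`, `D` are the queue lengths, the external arrivals and the departures, `sA` and `sD` are
the modulating chains of the arrivals and of the service constraints, and `ℱ t` is the
information up to time `t`. Given `ℱ t`, the arrivals have law `arr (sA t)` (Markov-modulated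
Bernoulli arrivals), the departures have law `pol (X t) (sA t) (sD t)`, the two modulating chains
move according to `PA` and `PD`, and these four are independent. In particular `(X, sA, sD)` is a
time-homogeneous Markov chain. -/
structure IsQueueProcess {M : ℕ} {SA SD Ω : Type*} {mΩ : MeasurableSpace Ω} (μ : Measure Ω)
    (R : Matrix (Fin M) (Fin M) ℝ) (PA : SA → PMF SA) (PD : SD → PMF SD)
    (arr : SA → PMF (Fin M → ℕ)) (pol : (Fin M → ℕ) → SA → SD → PMF (Fin M → ℝ))
    (ℱ : Filtration ℕ mΩ) (X : ℕ → Ω → Fin M → ℕ) (sA : ℕ → Ω → SA) (sD : ℕ → Ω → SD)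
    (A : ℕ → Ω → Fin M → ℕ) (D : ℕ → Ω → Fin M → ℝ) : Prop where
  measurable_X : ∀ t x, MeasurableSet[ℱ t] {ω | X t ω = x}
  measurable_sA : ∀ t s, MeasurableSet[ℱ t] {ω | sA t ω = s}
  measurable_sD : ∀ t s, MeasurableSet[ℱ t] {ω | sD t ω = s}
  measurable_A : ∀ t, Measurable (A t)
  measurable_D : ∀ t, Measurable (D t)
  /-- `X (t+1) = X t + A t - D t (I - R)`. -/
  evolution : ∀ t, ∀ᵐ ω ∂μ, ∀ m,
    (X (t + 1) ω m : ℝ) = X t ω m + A t ω m - Matrix.vecMul (D t ω) (1 - R) m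
  law : ∀ t (B : Set Ω), MeasurableSet[ℱ t] B →
    ∀ (x : Fin M → ℕ) (s : SA) (e : SD) (a : Fin M → ℕ) (d : Fin M → ℝ) (s' : SA) (e' : SD),
      μ (B ∩ {ω | X t ω = x ∧ sA t ω = s ∧ sD t ω = e} ∩
          {ω | A t ω = a ∧ D t ω = d ∧ sA (t + 1) ω = s' ∧ sD (t + 1) ω = e'}) =
        μ (B ∩ {ω | X t ω = x ∧ sA t ω = s ∧ sD t ω = e}) *
          (arr s a * pol x s e d * PA s s' * PD e e')

/-- `F`-stability: `limsup_{t → ∞} 𝔼[F(X_t)] < ∞`. -/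
def IsFStable {M : ℕ} {Ω : Type*} {mΩ : MeasurableSpace Ω} (μ : Measure Ω)
    (F : EuclideanSpace ℝ (Fin M) → ℝ) (X : ℕ → Ω → Fin M → ℕ) : Prop :=
  limsup (fun t => ∫⁻ ω, ENNReal.ofReal (F (countVec (X t ω))) ∂μ) atTop < ⊤

/-! ### The conditions on `G` -/

/-- The conditions on the potential `G`. Limits are taken as `‖X‖ → ∞` within the orthant,
uniformly in the direction of `X`. -/
structure IsStrongPotential {M : ℕ} (R : Matrix (Fin M) (Fin M) ℝ)
    (G : EuclideanSpace ℝ (Fin M) → ℝ) : Prop where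
  smooth : ContDiffOn ℝ ((⊤ : ℕ∞) : WithTop ℕ∞) G (orthant M)
  superlinear : Tendsto (fun x => G x / ‖x‖) (atInftyOrthant M) atTop
  /-- The derivative of some order `h₀` is bounded near infinity, and each derivative of order
  `h + 1 ≤ h₀` is negligible with respect to the derivative of order `h`. -/
  polynomial : ∃ h₀ : ℕ,
    (∃ c : ℝ, ∀ᶠ x in atInftyOrthant M, ‖iteratedFDerivWithin ℝ h₀ G (orthant M) x‖ ≤ c) ∧
    ∀ h < h₀, (fun x => iteratedFDerivWithin ℝ (h + 1) G (orthant M) x)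
      =o[atInftyOrthant M] (fun x => iteratedFDerivWithin ℝ h G (orthant M) x)
  /-- Pressures of empty queues are not positive. -/
  orientation : ∀ x ∈ orthant M, ∀ D : Fin M → ℝ, 0 ≤ D →
    dotProduct (WithLp.ofLp x) D = 0 → pressureProd R G x D ≤ 0
  /-- `⟨∇G(x) (I - R)ᵀ · D⟩ / ‖∇G(x)‖` is bounded away from `0` at infinity for some `D ≥ 0`;
  the vector `D` may depend on `x`, within a bounded set. -/
  positivity : ∃ c : ℝ, 0 < c ∧ ∀ᶠ x in atInftyOrthant M, ∃ D : Fin M → ℝ,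
    0 ≤ D ∧ D ≤ 1 ∧ c * ‖grad G x‖ ≤ pressureProd R G x D

end

/-! The proof is a Foster-Lyapunov argument for the Markov chain formed by the queue lengths and the
two modulating states. Since the second derivative of `G` is negligible against the gradient, a
bounded increment changes `G` by its first-order term up to `o(‖∇G‖)` (`grad_sub_le`,
`sub_sub_inner_grad_le`). That term is the gradient paired with the arrivals, minus the pressure of
the departures. By the orientation condition, truncating an optimal vertex at the queue lengths
costs only `o(‖∇G‖)`, so the policy nearly attains the maximal pressure of the current service
region (`IsServiceModel.maxPressure_le_choice`).

In a fixed modulating state the resulting drift may be positive; only its average under the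
stationary laws is controlled. Solutions of the Poisson equation give corrections of size `O(‖∇G‖)`,
slowly varying in `x`, which replace the arrivals and the maximal pressures by their stationary
means (`exists_arrival_correction`, `exists_service_correction`). Admissibility leaves room to
enlarge the workload in a direction of positive pressure, so the averaged drift is at most `-δ ‖∇G‖`
(`IsAdmissibleRate.exists_slack`). The corrections are dominated by `G` near infinity because `‖∇G‖
= o(|G|)`, so a constant makes the corrected potential nonnegative (`exists_drift_potential`).

Summing the drift inequality would only bound time averages. `expectation_le_of_drift` bounds the
expectation at each time instead, by splitting trajectories at their last visit to a finite
exceptional set; it needs neither irreducibility nor aperiodicity of the queue chain. If the order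
`h₀` in the growth condition is below two, the gradient is already bounded near infinity and no
drift is needed. -/

noncomputable section

/-! ### Finite irreducible Markov chains -/

/-- The expectation of a real function under a probability mass function. -/
def pmfMean {β : Type*} (p : PMF β) (ψ : β → ℝ) : ℝ := ∑' b, (p b).toReal * ψ b

lemma summable_pmfMean {β : Type*} (p : PMF β) (hp : p.support.Finite) (ψ : β → ℝ) :
    Summable fun b => (p b).toReal * ψ b := by
  refine summable_of_hasFiniteSupport (hp.subset fun b hb => ?_)
  rw [PMF.mem_support_iff]
  rintro h
  simp [h] at hb

lemma pmf_tsum_toReal {β : Type*} (p : PMF β) : ∑' b, (p b).toReal = 1 := by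
  rw [← ENNReal.tsum_toReal_eq (fun b => p.apply_ne_top b), p.tsum_coe, ENNReal.toReal_one]

lemma pmfMean_const {β : Type*} (p : PMF β) (c : ℝ) : pmfMean p (fun _ => c) = c := by
  rw [pmfMean, tsum_mul_right, pmf_tsum_toReal, one_mul]

lemma pmfMean_add {β : Type*} (p : PMF β) (hp : p.support.Finite) (ψ φ : β → ℝ) :
    pmfMean p (fun b => ψ b + φ b) = pmfMean p ψ + pmfMean p φ := by
  simp only [pmfMean, mul_add]
  exact (summable_pmfMean p hp ψ).tsum_add (summable_pmfMean p hp φ)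

lemma pmfMean_const_mul {β : Type*} (p : PMF β) (c : ℝ) (ψ : β → ℝ) :
    pmfMean p (fun b => c * ψ b) = c * pmfMean p ψ := by
  simp only [pmfMean, mul_left_comm _ c]
  exact tsum_mul_left

lemma pmfMean_finset_sum {β ι : Type*} (p : PMF β) (hp : p.support.Finite) (t : Finset ι)
    (ψ : ι → β → ℝ) :
    pmfMean p (fun b => ∑ i ∈ t, ψ i b) = ∑ i ∈ t, pmfMean p (ψ i) := by
  simp only [pmfMean, Finset.mul_sum]
  exact Summable.tsum_finsetSum fun i _ => summable_pmfMean p hp (ψ i)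

lemma pmfMean_nonneg {β : Type*} (p : PMF β) (ψ : β → ℝ) (h : ∀ b ∈ p.support, 0 ≤ ψ b) :
    0 ≤ pmfMean p ψ := by
  refine tsum_nonneg fun b => ?_
  by_cases hb : b ∈ p.support
  · exact mul_nonneg ENNReal.toReal_nonneg (h b hb)
  · rw [PMF.mem_support_iff, not_not] at hb
    simp [hb]

/-- Links the real means, in which the signed corrections are computed, to the extended nonnegative
sums of the transition operator. -/
lemma tsum_pmf_mul_ofReal {β : Type*} (p : PMF β) (hp : p.support.Finite) (ψ : β → ℝ)
    (h : ∀ b ∈ p.support, 0 ≤ ψ b) :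
    ∑' b, p b * ENNReal.ofReal (ψ b) = ENNReal.ofReal (pmfMean p ψ) := by
  rw [pmfMean, ENNReal.ofReal_tsum_of_nonneg _ (summable_pmfMean p hp ψ)]
  · refine tsum_congr fun b => ?_
    rw [ENNReal.ofReal_mul ENNReal.toReal_nonneg, ENNReal.ofReal_toReal (p.apply_ne_top b)]
  · intro b
    by_cases hb : b ∈ p.support
    · exact mul_nonneg ENNReal.toReal_nonneg (h b hb)
    · rw [PMF.mem_support_iff, not_not] at hb
      simp [hb]

/-- Harmonic functions of a finite irreducible chain are constant. -/
lemma IsIrreducibleChain.harmonic_const {S : Type*} [Fintype S] {P : S → PMF S}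
    (hP : IsIrreducibleChain P) {f : S → ℝ} (hf : ∀ s, pmfMean (P s) f = f s) (s t : S) :
    f s = f t := by
  have : Nonempty S := ⟨s⟩
  obtain ⟨u, hu⟩ := Finite.exists_max f
  -- Maximum principle: at a state where `f` is maximal, the nonnegative function `f u - f` has mean
  -- zero, hence vanishes at every possible successor.
  have key : ∀ v, f v = f u := by
    intro v
    induction hP u v with
    | refl => rfl
    | @tail a b _ hab ih =>
      have h1 : pmfMean (P a) (fun w => f u + (-1) * f w) = 0 := by
        rw [pmfMean_add _ (Set.toFinite _), pmfMean_const, pmfMean_const_mul, hf, ih]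
        ring
      have h2 : (P a b).toReal * (f u + (-1) * f b) = 0 := by
        rw [pmfMean, tsum_fintype] at h1
        refine (Finset.sum_eq_zero_iff_of_nonneg fun w _ => ?_).1 h1 b (Finset.mem_univ b)
        exact mul_nonneg ENNReal.toReal_nonneg (by linarith [hu w])
      have h3 : (P a b).toReal ≠ 0 :=
        (ENNReal.toReal_pos ((PMF.mem_support_iff _ _).1 hab) ((P a).apply_ne_top b)).ne'
      linarith [(mul_eq_zero.1 h2).resolve_left h3]
  rw [key s, key t]

/-- Stationarity in dual form: it places the range of `I - P` inside the kernel of the mean under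
`π`. -/
lemma IsStationaryFor.mean_mean {S : Type*} [Fintype S] {P : S → PMF S} {π : PMF S}
    (hπ : IsStationaryFor P π) (f : S → ℝ) :
    pmfMean π (fun s => pmfMean (P s) f) = pmfMean π f := by
  have h : ∀ t, ∑ s, (π s).toReal * (P s t).toReal = (π t).toReal := by
    intro t
    conv_rhs => rw [← hπ]
    rw [PMF.bind_apply, tsum_fintype, ENNReal.toReal_sum]
    · simp
    · intro s _
      exact ENNReal.mul_ne_top (π.apply_ne_top s) ((P s).apply_ne_top t)
  simp only [pmfMean, tsum_fintype, Finset.mul_sum]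
  rw [Finset.sum_comm]
  refine Finset.sum_congr rfl fun t _ => ?_
  rw [← h t, Finset.sum_mul]
  exact Finset.sum_congr rfl fun s _ => by ring

/-- The expectation under a probability mass function on a finite type, as a linear form. -/
def pmfMeanLin {S : Type*} [Fintype S] (p : PMF S) : (S → ℝ) →ₗ[ℝ] ℝ where
  toFun := pmfMean p
  map_add' f g := pmfMean_add p (Set.toFinite _) f g
  map_smul' c f := pmfMean_const_mul p c f

/-- The Poisson equation of a finite irreducible chain. -/
lemma IsIrreducibleChain.exists_poisson {S : Type*} [Fintype S] {P : S → PMF S}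
    (hP : IsIrreducibleChain P) {π : PMF S} (hπ : IsStationaryFor P π) (v : S → ℝ)
    (hv : pmfMean π v = 0) : ∃ c : S → ℝ, ∀ s, c s - pmfMean (P s) c = v s := by
  obtain ⟨s₀, -⟩ := π.support_nonempty
  let L : (S → ℝ) →ₗ[ℝ] (S → ℝ) := LinearMap.id - LinearMap.pi fun s => pmfMeanLin (P s)
  have hL : ∀ f s, L f s = f s - pmfMean (P s) f := fun f s => rfl
  have hle : LinearMap.range L ≤ LinearMap.ker (pmfMeanLin π) := by
    rintro _ ⟨f, rfl⟩
    rw [LinearMap.mem_ker]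
    have h1 : L f = f + (-1 : ℝ) • fun s => pmfMean (P s) f := by
      ext s
      simp [hL, sub_eq_add_neg]
    rw [h1, map_add, map_smul]
    change pmfMean π f + (-1 : ℝ) • pmfMean π (fun s => pmfMean (P s) f) = 0
    rw [hπ.mean_mean]
    simp
  -- The kernel of `I - P` consists of harmonic functions, hence of constants. By rank-nullity the
  -- range of `I - P` is then at least as large as the hyperplane of mean-zero functions that
  -- contains it.
  have hker : Module.finrank ℝ (LinearMap.ker L) ≤ 1 := by
    refine finrank_le_one ⟨fun _ => 1, ?_⟩ fun w => ⟨w.1 s₀, ?_⟩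
    · rw [LinearMap.mem_ker]
      ext s
      rw [hL, pmfMean_const]
      simp
    · ext s
      have : ∀ s, pmfMean (P s) w.1 = w.1 s := by
        intro s
        have := congrFun (LinearMap.mem_ker.1 w.2) s
        rw [hL] at this
        simp only [Pi.zero_apply] at this
        linarith
      simp [hP.harmonic_const this s s₀]
  have hrange : LinearMap.range (pmfMeanLin π) = ⊤ := by
    refine LinearMap.range_eq_top.2 fun c => ⟨fun _ => c, pmfMean_const π c⟩
  have e1 := LinearMap.finrank_range_add_finrank_ker L
  have e2 := LinearMap.finrank_range_add_finrank_ker (pmfMeanLin π)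
  rw [hrange, finrank_top, Module.finrank_self] at e2
  have heq : LinearMap.range L = LinearMap.ker (pmfMeanLin π) :=
    Submodule.eq_of_le_of_finrank_le hle (by omega)
  have hmem : v ∈ LinearMap.range L := by
    rw [heq, LinearMap.mem_ker]
    exact hv
  obtain ⟨c, hc⟩ := hmem
  exact ⟨c, fun s => by rw [← hL, hc]⟩

/-- A linear solution operator of the Poisson equation. -/
lemma IsIrreducibleChain.exists_poisson_kernel {S : Type*} [Fintype S] {P : S → PMF S}
    (hP : IsIrreducibleChain P) {π : PMF S} (hπ : IsStationaryFor P π) :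
    ∃ Z : S → S → ℝ, ∀ (v : S → ℝ) (s : S),
      ∑ u, Z s u * v u - pmfMean (P s) (fun s' => ∑ u, Z s' u * v u) = v s - pmfMean π v := by
  classical
  -- Solving for the centred indicator of each state suffices, by linearity. A kernel independent of
  -- `v` gives estimates uniform in `v`, which is needed when `v` depends on the queue lengths.
  have h : ∀ u : S, ∃ c : S → ℝ, ∀ s, c s - pmfMean (P s) c =
      (Pi.single u (1 : ℝ) : S → ℝ) s - (π u).toReal := by
    intro u
    refine hP.exists_poisson hπ _ ?_
    simp only [sub_eq_add_neg]
    rw [pmfMean_add _ (Set.toFinite _), pmfMean_const, pmfMean, tsum_fintype]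
    simp [Pi.single_apply]
  choose c hc using h
  refine ⟨fun s u => c u s, fun v s => ?_⟩
  rw [pmfMean_finset_sum _ (Set.toFinite _), ← Finset.sum_sub_distrib]
  have h1 : ∀ u, c u s * v u - pmfMean (P s) (fun b => c u b * v u) =
      (Pi.single u (1 : ℝ) : S → ℝ) s * v u - (π u).toReal * v u := by
    intro u
    simp only [mul_comm _ (v u)]
    rw [pmfMean_const_mul, ← mul_sub, hc]
    ring
  rw [Finset.sum_congr rfl fun u _ => h1 u]
  simp [Pi.single_apply, Finset.sum_sub_distrib, pmfMean, tsum_fintype]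

/-! ### Moment bounds from a drift condition -/

/-- If the potential `V` decreases by `f` in expectation outside of a finite set `C`, then the
expectation of `f` is bounded uniformly in time; this is proved by decomposing trajectories at
their last visit of `C`. The functional `E t` is the expectation at time `t`, and `T` is the
transition operator. -/
lemma expectation_le_of_drift {S : Type*} (T : (S → ENNReal) → S → ENNReal)
    (hTmono : Monotone T) (hTadd : ∀ φ ψ, T (φ + ψ) = T φ + T ψ) (hTzero : T 0 = 0)
    (E : ℕ → (S → ENNReal) → ENNReal) (hEmono : ∀ t, Monotone (E t))
    (hEadd : ∀ t φ ψ, E t (φ + ψ) ≤ E t φ + E t ψ) (hEconst : ∀ t c, E t (fun _ => c) ≤ c)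
    (hE : ∀ t φ, E (t + 1) φ ≤ E t (T φ)) (C : Finset S) (f V : S → ENNReal)
    (hV : ∀ y ∉ C, T V y + f y ≤ V y) (t : ℕ) :
    E t f ≤ E 0 V + ∑ y ∈ C, (T V y + f y) := by
  classical
  let K : (S → ENNReal) → S → ENNReal := fun φ y => if y ∈ C then 0 else φ y
  -- For a Markov chain, `g n y` is the expectation of `f` at time `n`, starting from `y`, on the
  -- trajectories that avoid `C` at all times from `0` to `n`.
  let g : ℕ → S → ENNReal := fun n => Nat.rec (K f) (fun _ φ => K (T φ)) n
  have g_succ : ∀ n, g (n + 1) = K (T (g n)) := fun n => rfl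
  have hsum : ∀ n, ∑ j ∈ Finset.range n, g j ≤ V := by
    intro n
    have hT : ∀ n, T (∑ j ∈ Finset.range n, g j) = ∑ j ∈ Finset.range n, T (g j) := by
      intro n
      induction n with
      | zero => simpa using hTzero
      | succ n ih => rw [Finset.sum_range_succ, hTadd, ih, Finset.sum_range_succ]
    induction n with
    | zero => intro y; simp
    | succ n ih =>
      intro y
      rw [Finset.sum_range_succ', Pi.add_apply, Finset.sum_apply]
      by_cases hy : y ∈ C
      · simp [g, K, hy]
      · refine le_trans ?_ (hV y hy)
        refine add_le_add ?_ (by simp [g, K, hy])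
        have : ∀ j, g (j + 1) y = T (g j) y := fun j => by simp [g_succ, K, hy]
        simp only [this]
        rw [← Finset.sum_apply, ← hT]
        exact hTmono ih y
  have hTsum : ∀ n y, ∑ j ∈ Finset.range n, T (g j) y ≤ T V y := by
    intro n y
    refine le_trans (le_of_eq ?_) (hTmono (hsum n) y)
    induction n with
    | zero => simp [hTzero]
    | succ n ih => rw [Finset.sum_range_succ, ih, Finset.sum_range_succ, hTadd, Pi.add_apply]
  have hsplit : ∀ φ : S → ENNReal, φ ≤ (fun _ => ∑ c ∈ C, φ c) + K φ := by
    intro φ y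
    by_cases hy : y ∈ C
    · exact (Finset.single_le_sum (f := φ) (fun _ _ => zero_le) hy).trans le_self_add
    · simp [K, hy]
  have hle : ∀ s φ, E s φ ≤ ∑ c ∈ C, φ c + E s (K φ) := fun s φ =>
    ((hEmono s (hsplit φ)).trans (hEadd s _ _)).trans (add_le_add_left (hEconst s _) _)
  -- Going back one step at a time, the part of the trajectories that sits in `C` is split off; the
  -- probability of each state there is bounded by one.
  have hchain : ∀ n s j, E (n + s) (g j) ≤
      ∑ i ∈ Finset.range n, ∑ c ∈ C, T (g (j + i)) c + E s (g (j + n)) := by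
    intro n s
    induction n with
    | zero => intro j; simp
    | succ n ih =>
      intro j
      have h1 : E (n + 1 + s) (g j) ≤ ∑ c ∈ C, T (g j) c + E (n + s) (g (j + 1)) := by
        rw [add_right_comm]
        exact (hE _ _).trans (hle _ _)
      refine h1.trans ((add_le_add_right (ih (j + 1)) _).trans (le_of_eq ?_))
      rw [Finset.sum_range_succ', ← add_assoc, add_zero, add_comm (∑ c ∈ C, T (g j) c)]
      congr 1
      · congr 1
        exact Finset.sum_congr rfl fun i _ => by rw [add_right_comm, add_assoc]
      · rw [add_right_comm, add_assoc]
  have h2 := hchain t 0 0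
  simp only [add_zero, zero_add] at h2
  have h3 : E 0 (g t) ≤ E 0 V := by
    refine hEmono 0 (le_trans ?_ (hsum (t + 1)))
    rw [Finset.sum_range_succ]
    exact le_add_self
  -- The sum over the time elapsed since the last visit is bounded independently of `t`, because the
  -- functions `g i` sum to at most `V`.
  have h4 : ∑ i ∈ Finset.range t, ∑ c ∈ C, T (g i) c ≤ ∑ c ∈ C, T V c := by
    rw [Finset.sum_comm]
    exact Finset.sum_le_sum fun c _ => hTsum t c
  calc E t f ≤ ∑ c ∈ C, f c + E t (g 0) := hle t f
    _ ≤ ∑ c ∈ C, f c + (∑ c ∈ C, T V c + E 0 V) :=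
        add_le_add_right (h2.trans (add_le_add h4 h3)) _
    _ = _ := by rw [Finset.sum_add_distrib]; ring

/-- The integral of a function of a random variable that is carried by its atoms. -/
lemma lintegral_eq_tsum_atoms {Ω β : Type*} {mΩ : MeasurableSpace Ω} (μ : Measure Ω)
    [IsProbabilityMeasure μ] (Z : Ω → β) (hm : ∀ b, MeasurableSet {ω | Z ω = b})
    (hs : ∑' b, μ {ω | Z ω = b} = 1) (φ : Ω → ENNReal) (c : β → ENNReal)
    (hφ : ∀ᵐ ω ∂μ, φ ω = c (Z ω)) : ∫⁻ ω, φ ω ∂μ = ∑' b, μ {ω | Z ω = b} * c b := by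
  -- The type `β` may be uncountable, since departures are real vectors, but a finite total mass
  -- allows only countably many atoms of positive mass.
  let N : Set β := Function.support fun b => μ {ω | Z ω = b}
  have hN : N.Countable := Summable.countable_support_ennreal (by rw [hs]; simp)
  have : Countable N := hN
  let U : N → Set Ω := fun b => {ω | Z ω = b}
  have hU : ∀ b, MeasurableSet (U b) := fun b => hm b
  have hd : Pairwise (Function.onFun Disjoint U) := by
    intro a b hab
    refine Set.disjoint_left.2 fun ω ha hb => hab (Subtype.ext ?_)
    exact (show Z ω = a from ha).symm.trans hb
  have hsub : ∀ F : β → ENNReal, (∑' b : N, μ {ω | Z ω = b} * F b) =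
      ∑' b, μ {ω | Z ω = b} * F b := by
    intro F
    refine tsum_subtype_eq_of_support_subset (f := fun b => μ {ω | Z ω = b} * F b) fun b hb => ?_
    exact left_ne_zero_of_mul hb
  have hfull : μ (⋃ b, U b) = 1 := by
    rw [measure_iUnion hd hU, ← hs]
    simpa using hsub (fun _ => 1)
  have hae : ∀ᵐ ω ∂μ, ω ∈ ⋃ b, U b := by
    exact (prob_compl_eq_zero_iff (MeasurableSet.iUnion hU)).2 hfull
  rw [lintegral_congr_ae hφ, ← Measure.restrict_eq_self_of_ae_mem hae, lintegral_iUnion hU hd,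
    Measure.restrict_eq_self_of_ae_mem hae, ← hsub]
  refine tsum_congr fun b => ?_
  rw [setLIntegral_congr_fun (g := fun _ => c b) (hU b) fun ω hω => congrArg c hω]
  rw [setLIntegral_const, mul_comm]

/-! ### The orthant -/

lemma convex_orthant (M : ℕ) : Convex ℝ (orthant M) := by
  intro x hx y hy a b ha hb _ m
  have h1 := mul_nonneg ha (hx m)
  have h2 := mul_nonneg hb (hy m)
  simpa using add_nonneg h1 h2

lemma uniqueDiffOn_orthant (M : ℕ) : UniqueDiffOn ℝ (orthant M) := by
  refine uniqueDiffOn_convex (convex_orthant M) ⟨WithLp.toLp 2 fun _ => 1, ?_⟩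
  have hopen : IsOpen (⋂ m : Fin M, {x : EuclideanSpace ℝ (Fin M) | 0 < x m}) :=
    isOpen_iInter_of_finite fun m => isOpen_lt continuous_const (by fun_prop)
  refine interior_maximal (fun x hx m => ?_) hopen ?_
  · exact le_of_lt (Set.mem_iInter.1 hx m)
  · simp

lemma countVec_mem_orthant {M : ℕ} (x : Fin M → ℕ) : countVec x ∈ orthant M := fun m => by
  simp [countVec]

lemma eventually_atInftyOrthant {M : ℕ} {p : EuclideanSpace ℝ (Fin M) → Prop} :
    (∀ᶠ x in atInftyOrthant M, p x) ↔ ∃ K : ℝ, ∀ x ∈ orthant M, K ≤ ‖x‖ → p x := by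
  rw [atInftyOrthant, eventually_inf_principal, ← comap_norm_atTop, eventually_comap,
    eventually_atTop]
  exact ⟨fun ⟨K, h⟩ => ⟨K, fun x hx hK => h _ hK x rfl hx⟩,
    fun ⟨K, h⟩ => ⟨K, fun b hb x hx hxo => h x hxo (hx ▸ hb)⟩⟩

/-- Queue lengths are lattice points, so every estimate valid near infinity fails for finitely many
of them at most. -/
lemma finite_norm_countVec_lt (M : ℕ) (K : ℝ) : {x : Fin M → ℕ | ‖countVec x‖ < K}.Finite := by
  refine (Set.finite_Iic (fun _ : Fin M => ⌈K⌉₊)).subset fun x hx m => ?_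
  have h1 : (x m : ℝ) ≤ ‖countVec x‖ := by
    have := PiLp.norm_apply_le (countVec x) m
    simpa [countVec] using this
  have h2 : (x m : ℝ) ≤ ⌈K⌉₊ := (h1.trans hx.le).trans (Nat.le_ceil K)
  exact_mod_cast h2

lemma exists_le_countVec {M : ℕ} (F : (Fin M → ℕ) → ℝ) (K : ℝ) :
    ∃ b : ℝ, 0 ≤ b ∧ ∀ x, ‖countVec x‖ < K → F x ≤ b := by
  obtain ⟨b, hb⟩ := ((finite_norm_countVec_lt M K).image F).bddAbove
  exact ⟨max b 0, le_max_right _ _, fun x hx =>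
    (hb (Set.mem_image_of_mem F hx)).trans (le_max_left _ _)⟩

/-! ### The potential -/

lemma hasFDerivWithinAt_inner_grad {M : ℕ} {G : EuclideanSpace ℝ (Fin M) → ℝ}
    {x : EuclideanSpace ℝ (Fin M)} (h : DifferentiableWithinAt ℝ G (orthant M) x) :
    HasFDerivWithinAt G (innerSL ℝ (grad G x)) (orthant M) x := by
  exact h.hasGradientWithinAt.hasFDerivWithinAt

lemma norm_grad_sub {M : ℕ} (G : EuclideanSpace ℝ (Fin M) → ℝ)
    (x z : EuclideanSpace ℝ (Fin M)) :
    ‖grad G z - grad G x‖ =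
      ‖fderivWithin ℝ G (orthant M) z - fderivWithin ℝ G (orthant M) x‖ := by
  rw [grad, grad, gradientWithin, gradientWithin, ← map_sub, LinearIsometryEquiv.norm_map]

lemma norm_grad {M : ℕ} (G : EuclideanSpace ℝ (Fin M) → ℝ) (x : EuclideanSpace ℝ (Fin M)) :
    ‖grad G x‖ = ‖fderivWithin ℝ G (orthant M) x‖ := by
  rw [grad, gradientWithin, LinearIsometryEquiv.norm_map]

/-- Either the gradient is bounded near infinity, or it is negligible with respect to `G` and
the second derivative is negligible with respect to it. -/
lemma IsStrongPotential.grad_bounded_or {M : ℕ} {R : Matrix (Fin M) (Fin M) ℝ}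
    {G : EuclideanSpace ℝ (Fin M) → ℝ} (hG : IsStrongPotential R G) :
    (∃ c K : ℝ, ∀ x ∈ orthant M, K ≤ ‖x‖ → ‖grad G x‖ ≤ c) ∨
    ((∀ ε > 0, ∃ K : ℝ, ∀ x ∈ orthant M, K ≤ ‖x‖ → ‖grad G x‖ ≤ ε * |G x|) ∧
      ∀ ε > 0, ∃ K : ℝ, ∀ x ∈ orthant M, K ≤ ‖x‖ →
        ‖fderivWithin ℝ (fderivWithin ℝ G (orthant M)) (orthant M) x‖ ≤ ε * ‖grad G x‖) := by
  have hu := uniqueDiffOn_orthant M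
  obtain ⟨h₀, ⟨c, hc⟩, hh⟩ := hG.polynomial
  obtain ⟨K, hK⟩ := eventually_atInftyOrthant.1 hc
  rcases Nat.lt_or_ge h₀ 2 with h | h
  · left
    interval_cases h₀
    · obtain ⟨K', hK'⟩ := eventually_atInftyOrthant.1 (hG.superlinear.eventually_ge_atTop 1)
      -- The constant `0` is arbitrary: beyond this threshold `c + 1 ≤ ‖x‖ ≤ G x ≤ c`, so no such
      -- `x` exists.
      refine ⟨0, max (max K K') (max 1 (c + 1)), fun x hx hxK => ?_⟩
      simp only [max_le_iff] at hxK
      have h1 := hK x hx hxK.1.1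
      have h2 := hK' x hx hxK.1.2
      rw [norm_iteratedFDerivWithin_zero, Real.norm_eq_abs] at h1
      rw [one_le_div (by linarith)] at h2
      have := le_abs_self (G x)
      linarith
    · refine ⟨c, K, fun x hx hxK => ?_⟩
      rw [norm_grad, ← norm_iteratedFDerivWithin_one _ (hu x hx)]
      exact hK x hx hxK
  · right
    constructor
    · intro ε hε
      obtain ⟨K, hK⟩ := eventually_atInftyOrthant.1 ((hh 0 (by omega)).def hε)
      refine ⟨K, fun x hx hxK => ?_⟩
      have := hK x hx hxK
      rwa [zero_add, norm_iteratedFDerivWithin_one _ (hu x hx), norm_iteratedFDerivWithin_zero,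
        ← norm_grad, Real.norm_eq_abs] at this
    · intro ε hε
      obtain ⟨K, hK⟩ := eventually_atInftyOrthant.1 ((hh 1 (by omega)).def hε)
      refine ⟨K, fun x hx hxK => ?_⟩
      have := hK x hx hxK
      rwa [norm_iteratedFDerivWithin_one _ (hu x hx), ← norm_iteratedFDerivWithin_fderivWithin hu hx,
        norm_iteratedFDerivWithin_one _ (hu x hx), ← norm_grad] at this

/-- If the second derivative is negligible with respect to the gradient, then the relative
variation of the gradient over bounded distances vanishes at infinity. -/
lemma grad_sub_le {M : ℕ} {G : EuclideanSpace ℝ (Fin M) → ℝ}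
    (hs : ContDiffOn ℝ ((⊤ : ℕ∞) : WithTop ℕ∞) G (orthant M))
    (h2 : ∀ ε > 0, ∃ K : ℝ, ∀ x ∈ orthant M, K ≤ ‖x‖ →
        ‖fderivWithin ℝ (fderivWithin ℝ G (orthant M)) (orthant M) x‖ ≤ ε * ‖grad G x‖)
    (r : ℝ) (hr : 0 < r) (ε : ℝ) (hε : 0 < ε) :
    ∃ K : ℝ, ∀ x ∈ orthant M, K ≤ ‖x‖ → ∀ z ∈ orthant M, ‖z - x‖ ≤ r →
      ‖grad G z - grad G x‖ ≤ ε * ‖grad G x‖ := by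
  have hu := uniqueDiffOn_orthant M
  set η := min (1 / (2 * r)) (ε / (2 * r)) with hη
  have hη0 : 0 < η := by positivity
  have hη1 : η * r ≤ 1 / 2 := by
    calc η * r ≤ 1 / (2 * r) * r := by gcongr; exact min_le_left _ _
      _ = 1 / 2 := by field_simp
  have hη2 : η * r * 2 ≤ ε := by
    calc η * r * 2 ≤ ε / (2 * r) * r * 2 := by gcongr; exact min_le_right _ _
      _ = ε := by field_simp
  obtain ⟨K, hK⟩ := h2 η hη0
  -- The shift by `r` keeps the whole ball of radius `r` around `x` in the range where the second
  -- derivative is controlled.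
  refine ⟨K + r, fun x hx hxK => ?_⟩
  have hdiff : DifferentiableOn ℝ (fderivWithin ℝ G (orthant M)) (orthant M) :=
    (hs.fderivWithin hu (m := 1) (by norm_num; exact WithTop.coe_le_coe.2 le_top)).differentiableOn (by simp)
  set B := orthant M ∩ Metric.closedBall x r with hB
  have hconv : Convex ℝ B := (convex_orthant M).inter (convex_closedBall x r)
  have hcomp : IsCompact B := by
    refine (isCompact_closedBall x r).inter_left ?_
    have : orthant M = ⋂ m : Fin M, {x : EuclideanSpace ℝ (Fin M) | 0 ≤ x m} := by
      ext; simp [orthant]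
    rw [this]
    exact isClosed_iInter fun m => isClosed_le continuous_const (by fun_prop)
  have hxB : x ∈ B := ⟨hx, Metric.mem_closedBall_self hr.le⟩
  obtain ⟨w, hwB, hw⟩ := hcomp.exists_isMaxOn ⟨x, hxB⟩
    ((hdiff.continuousOn.mono (Set.inter_subset_left)).norm)
  set S := ‖fderivWithin ℝ G (orthant M) w‖ with hS
  have hS0 : 0 ≤ S := norm_nonneg _
  have hderiv : ∀ y ∈ B, HasFDerivWithinAt (fderivWithin ℝ G (orthant M))
      (fderivWithin ℝ (fderivWithin ℝ G (orthant M)) (orthant M) y) B y := fun y hy =>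
    (hdiff y hy.1).hasFDerivWithinAt.mono Set.inter_subset_left
  have hbound : ∀ y ∈ B,
      ‖fderivWithin ℝ (fderivWithin ℝ G (orthant M)) (orthant M) y‖ ≤ η * S := by
    intro y hy
    have h3 : K ≤ ‖y‖ := by
      have h4 : ‖y - x‖ ≤ r := by simpa [dist_eq_norm] using hy.2
      have h5 : ‖x‖ - ‖y‖ ≤ ‖x - y‖ := norm_sub_norm_le x y
      rw [norm_sub_rev] at h5
      linarith
    refine (hK y hy.1 h3).trans ?_
    rw [norm_grad]
    exact mul_le_mul_of_nonneg_left (hw hy) hη0.le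
  have hvar : ∀ z ∈ B, ‖fderivWithin ℝ G (orthant M) z - fderivWithin ℝ G (orthant M) x‖ ≤
      η * r * S := by
    intro z hz
    refine (hconv.norm_image_sub_le_of_norm_hasFDerivWithin_le hderiv hbound hxB hz).trans ?_
    have h4 : ‖z - x‖ ≤ r := by simpa [dist_eq_norm] using hz.2
    calc η * S * ‖z - x‖ ≤ η * S * r := by gcongr
      _ = _ := by ring
  -- The second derivative is bounded through the gradient at the same point, not at `x`. The
  -- maximum `S` over the ball is absorbed: `η * r ≤ 1 / 2` gives `S ≤ ‖grad G x‖ + S / 2`.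
  have hS2 : S ≤ 2 * ‖grad G x‖ := by
    have h3 := hvar w hwB
    have h4 := norm_sub_norm_le (fderivWithin ℝ G (orthant M) w) (fderivWithin ℝ G (orthant M) x)
    have h5 : η * r * S ≤ 1 / 2 * S := by gcongr
    rw [norm_grad]
    linarith
  intro z hz hzx
  rw [norm_grad_sub]
  refine (hvar z ⟨hz, by simpa [dist_eq_norm] using hzx⟩).trans ?_
  calc η * r * S ≤ η * r * (2 * ‖grad G x‖) := by gcongr
    _ = η * r * 2 * ‖grad G x‖ := by ring
    _ ≤ _ := by gcongr

/-- The first-order expansion of `G` along bounded increments. -/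
lemma sub_sub_inner_grad_le {M : ℕ} {G : EuclideanSpace ℝ (Fin M) → ℝ}
    (hs : ContDiffOn ℝ ((⊤ : ℕ∞) : WithTop ℕ∞) G (orthant M)) {r ε : ℝ}
    {x z : EuclideanSpace ℝ (Fin M)} (hx : x ∈ orthant M) (hz : z ∈ orthant M) (hzx : ‖z - x‖ ≤ r)
    (h : ∀ y ∈ orthant M, ‖y - x‖ ≤ r → ‖grad G y - grad G x‖ ≤ ε * ‖grad G x‖) :
    G z ≤ G x + inner ℝ (grad G x) (z - x) + r * ε * ‖grad G x‖ := by
  have hr : 0 ≤ r := (norm_nonneg _).trans hzx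
  have hxB : x ∈ orthant M ∩ Metric.closedBall x r := ⟨hx, Metric.mem_closedBall_self hr⟩
  have hconv : Convex ℝ (orthant M ∩ Metric.closedBall x r) :=
    (convex_orthant M).inter (convex_closedBall x r)
  have key := hconv.norm_image_sub_le_of_norm_hasFDerivWithin_le' (f := G) (x := x) (y := z)
    (f' := fun y => innerSL ℝ (grad G y)) (φ := innerSL ℝ (grad G x)) (C := ε * ‖grad G x‖)
    (fun y hy => (hasFDerivWithinAt_inner_grad
      (hs.differentiableOn (by simp) y hy.1)).mono Set.inter_subset_left)
    (fun y hy => by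
      rw [← map_sub, innerSL_apply_norm]
      exact h y hy.1 (by simpa [dist_eq_norm] using hy.2))
    hxB ⟨hz, by simpa [dist_eq_norm] using hzx⟩
  rw [innerSL_apply_apply, Real.norm_eq_abs] at key
  have h1 := (le_abs_self _).trans key
  have h0 : 0 ≤ ε * ‖grad G x‖ := (norm_nonneg _).trans (h z hz hzx)
  have h2 : ε * ‖grad G x‖ * ‖z - x‖ ≤ ε * ‖grad G x‖ * r := by gcongr
  linarith

/-- The net loss of customers `D (I - R)` due to departures `D`. -/
def netDeparture {M : ℕ} (R : Matrix (Fin M) (Fin M) ℝ) (D : Fin M → ℝ) :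
    EuclideanSpace ℝ (Fin M) :=
  WithLp.toLp 2 (Matrix.vecMul D (1 - R))

/-- With the transpose moved to the other side, the weighted pressure is the first-order decrease of
`G` caused by the departures `D`. -/
lemma pressureProd_eq_inner {M : ℕ} (R : Matrix (Fin M) (Fin M) ℝ)
    (G : EuclideanSpace ℝ (Fin M) → ℝ) (x : EuclideanSpace ℝ (Fin M)) (D : Fin M → ℝ) :
    pressureProd R G x D = inner ℝ (grad G x) (netDeparture R D) := by
  rw [pressureProd, Matrix.vecMul_transpose, netDeparture, EuclideanSpace.inner_eq_star_dotProduct]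
  simp only [star_trivial]
  rw [← Matrix.dotProduct_mulVec, dotProduct_comm]

lemma exists_norm_netDeparture_le {M : ℕ} (R : Matrix (Fin M) (Fin M) ℝ) (B : ℝ) :
    ∃ C : ℝ, 0 < C ∧ ∀ D : Fin M → ℝ, 0 ≤ D → (∀ m, D m ≤ B) → ‖netDeparture R D‖ ≤ C := by
  have hc : Continuous (netDeparture R) := by
    unfold netDeparture
    fun_prop
  obtain ⟨C, hC⟩ := ((isCompact_Icc (a := (0 : Fin M → ℝ)) (b := fun _ => B)).image
    hc).isBounded.exists_norm_le
  exact ⟨max C 1, by positivity, fun D h0 hB =>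
    (hC _ (Set.mem_image_of_mem _ ⟨h0, hB⟩)).trans (le_max_left _ _)⟩

/-! ### Maximal pressures -/

/-- The weighted total pressure, as a linear form in the vector of departures. -/
def pressureLin {M : ℕ} (R : Matrix (Fin M) (Fin M) ℝ) (G : EuclideanSpace ℝ (Fin M) → ℝ)
    (x : EuclideanSpace ℝ (Fin M)) : (Fin M → ℝ) →ₗ[ℝ] ℝ where
  toFun := pressureProd R G x
  map_add' D D' := by simp [pressureProd, dotProduct_add]
  map_smul' c D := by simp [pressureProd, dotProduct_smul]

lemma pressureLin_apply {M : ℕ} (R : Matrix (Fin M) (Fin M) ℝ)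
    (G : EuclideanSpace ℝ (Fin M) → ℝ) (x : EuclideanSpace ℝ (Fin M)) (D : Fin M → ℝ) :
    pressureLin R G x D = pressureProd R G x D := rfl

/-- The maximum of the pressure over the region of the service state `e`. -/
def maxPressure {M : ℕ} {SD : Type*} (R : Matrix (Fin M) (Fin M) ℝ)
    (G : EuclideanSpace ℝ (Fin M) → ℝ) (region : SD → Set (Fin M → ℝ))
    (x : EuclideanSpace ℝ (Fin M)) (e : SD) : ℝ :=
  sSup (pressureProd R G x '' region e)

section
variable {M : ℕ} {SD : Type*} {R : Matrix (Fin M) (Fin M) ℝ}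
  {G : EuclideanSpace ℝ (Fin M) → ℝ} {region feasible : SD → Set (Fin M → ℝ)}

/-- The maximal pressure is attained at a vertex. -/
lemma IsServiceModel.exists_vertex (hserv : IsServiceModel region feasible) (e : SD)
    (hne : (region e).Nonempty) (x : EuclideanSpace ℝ (Fin M)) :
    ∃ D ∈ Set.extremePoints ℝ (region e), maxPressure R G region x e = pressureProd R G x D ∧
      ∀ D' ∈ region e, pressureProd R G x D' ≤ pressureProd R G x D := by
  let l : StrongDual ℝ (Fin M → ℝ) := LinearMap.toContinuousLinearMap (pressureLin R G x)
  have hl : ∀ D, l D = pressureProd R G x D := fun D => rfl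
  have hexp : IsExposed ℝ (region e) (l.toExposed (region e)) :=
    ContinuousLinearMap.toExposed.isExposed
  obtain ⟨D₀, hD₀, hmax⟩ := (hserv.compact e).exists_isMaxOn hne l.continuous.continuousOn
  -- The maximizers form a compact exposed face; an extreme point of it is a vertex of the region,
  -- and vertices are known to be feasible.
  obtain ⟨D, hD⟩ := (hexp.isCompact (hserv.compact e)).extremePoints_nonempty
    ⟨D₀, hD₀, fun y hy => hmax hy⟩
  have hle : ∀ D' ∈ region e, pressureProd R G x D' ≤ pressureProd R G x D := fun D' hD' =>
    hD.1.2 D' hD'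
  refine ⟨D, hexp.isExtreme.extremePoints_subset_extremePoints hD, ?_, hle⟩
  refine IsGreatest.csSup_eq ⟨Set.mem_image_of_mem _ hD.1.1, ?_⟩
  rintro _ ⟨D', hD', rfl⟩
  exact hle D' hD'

lemma IsServiceModel.pressureProd_le (hserv : IsServiceModel region feasible) {e : SD}
    (x : EuclideanSpace ℝ (Fin M)) {D : Fin M → ℝ} (hD : D ∈ region e) :
    pressureProd R G x D ≤ maxPressure R G region x e := by
  obtain ⟨D', -, h1, h2⟩ := hserv.exists_vertex (R := R) (G := G) e ⟨D, hD⟩ x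
  exact h1 ▸ h2 D hD

lemma IsServiceModel.exists_bound [Fintype SD] (hserv : IsServiceModel region feasible) :
    ∃ B : ℝ, 0 < B ∧ ∀ e, ∀ D ∈ region e, ∀ m, D m ≤ B := by
  have h := fun e => (hserv.compact e).isBounded.exists_norm_le
  choose b hb using h
  obtain ⟨B, hB⟩ := (Set.finite_range b).bddAbove
  refine ⟨max B 1, by positivity, fun e D hD m => ?_⟩
  exact (le_abs_self _).trans ((norm_le_pi_norm D m).trans ((hb e D hD).trans
    ((hB ⟨e, rfl⟩).trans (le_max_left _ _))))

/-- An optimal vertex at `z` competes at `x`, which leaves only the change of gradient paired with a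
bounded net departure. This makes the service correction slowly varying. -/
lemma IsServiceModel.maxPressure_sub_le (hserv : IsServiceModel region feasible) {C : ℝ}
    (hC : ∀ e, ∀ D ∈ region e, ‖netDeparture R D‖ ≤ C) (e : SD) (hne : (region e).Nonempty)
    (x z : EuclideanSpace ℝ (Fin M)) :
    |maxPressure R G region z e - maxPressure R G region x e| ≤ C * ‖grad G z - grad G x‖ := by
  have key : ∀ x z, maxPressure R G region z e - maxPressure R G region x e ≤
      C * ‖grad G z - grad G x‖ := by
    intro x z
    obtain ⟨D, hD, h1, -⟩ := hserv.exists_vertex (R := R) (G := G) e hne z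
    have h2 := hserv.pressureProd_le (R := R) (G := G) x hD.1
    rw [h1]
    refine (sub_le_sub_left h2 _).trans ?_
    rw [pressureProd_eq_inner, pressureProd_eq_inner, ← inner_sub_left]
    refine (real_inner_le_norm _ _).trans ?_
    rw [mul_comm]
    exact mul_le_mul_of_nonneg_right (hC e D hD.1) (norm_nonneg _)
  rw [abs_sub_le_iff]
  refine ⟨key x z, ?_⟩
  rw [norm_sub_rev]
  exact key z x

lemma IsServiceModel.abs_maxPressure_le (hserv : IsServiceModel region feasible) {C : ℝ}
    (hC : ∀ e, ∀ D ∈ region e, ‖netDeparture R D‖ ≤ C) (e : SD) (hne : (region e).Nonempty)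
    (x : EuclideanSpace ℝ (Fin M)) : |maxPressure R G region x e| ≤ C * ‖grad G x‖ := by
  obtain ⟨D, hD, h1, -⟩ := hserv.exists_vertex (R := R) (G := G) e hne x
  rw [h1, pressureProd_eq_inner, mul_comm]
  refine (abs_real_inner_le_norm _ _).trans ?_
  exact mul_le_mul_of_nonneg_left (hC e D hD.1) (norm_nonneg _)

/-- The policy achieves the maximal pressure up to an error that is negligible with respect to
the gradient, despite the constraint that departures do not exceed queue lengths. -/
lemma IsServiceModel.maxPressure_le_choice [Fintype SD]
    (hserv : IsServiceModel region feasible) (hne : ∀ e, (region e).Nonempty)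
    (horient : ∀ x ∈ orthant M, ∀ D : Fin M → ℝ, 0 ≤ D →
      dotProduct (WithLp.ofLp x) D = 0 → pressureProd R G x D ≤ 0)
    (hgrad : ∀ r > 0, ∀ ε > 0, ∃ K : ℝ, ∀ x ∈ orthant M, K ≤ ‖x‖ → ∀ z ∈ orthant M,
      ‖z - x‖ ≤ r → ‖grad G z - grad G x‖ ≤ ε * ‖grad G x‖) (ε : ℝ) (hε : 0 < ε) :
    ∃ K : ℝ, ∀ x : Fin M → ℕ, K ≤ ‖countVec x‖ → ∀ e d,
      IsMaxScalarChoice R G feasible e x d →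
      maxPressure R G region (countVec x) e ≤
        pressureProd R G (countVec x) d + ε * ‖grad G (countVec x)‖ := by
  classical
  obtain ⟨B, hB0, hB⟩ := hserv.exists_bound
  obtain ⟨C, hC0, hC⟩ := exists_norm_netDeparture_le R 1
  -- Each of the `M` coordinates can lose at most `B * C * η * ‖∇G‖`; the `+ 1` keeps the
  -- denominator positive when `M = 0`.
  obtain ⟨K, hK⟩ := hgrad B hB0 (ε / (M * B * C + 1)) (by positivity)
  refine ⟨K, fun x hx e d hd => ?_⟩
  obtain ⟨D, hD, h1, -⟩ := hserv.exists_vertex (R := R) (G := G) e (hne e) (countVec x)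
  have hDf := hserv.vertices_feasible e hD
  have hD0 := hserv.nonneg e D hD.1
  have h2 : pressureProd R G (countVec x) (fun m => min (D m) (x m)) ≤
      pressureProd R G (countVec x) d :=
    hd.2 ⟨hserv.min_feasible e D hDf x, fun m => min_le_right _ _⟩
  have h3 : pressureProd R G (countVec x) D =
      pressureProd R G (countVec x) (fun m => min (D m) (x m)) +
      ∑ m, (D m - min (D m) (x m)) * pressureProd R G (countVec x) (Pi.single m 1) := by
    have h4 : D = (fun m => min (D m) (x m : ℝ)) +
        ∑ m, (D m - min (D m) (x m : ℝ)) • (Pi.single m 1 : Fin M → ℝ) := by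
      ext m
      simp [Finset.sum_apply, Pi.single_apply]
    conv_lhs => rw [← pressureLin_apply, h4, map_add, map_sum]
    simp only [map_smul, pressureLin_apply, smul_eq_mul]
  set g := ‖grad G (countVec x)‖ with hg
  set η := ε / (M * B * C + 1) with hη
  have hη0 : 0 < η := by positivity
  have h5 : ∀ m, (D m - min (D m) (x m)) * pressureProd R G (countVec x) (Pi.single m 1) ≤
      B * (C * (η * g)) := by
    intro m
    have hg0 : 0 ≤ g := norm_nonneg _
    rcases le_or_gt (D m) (x m) with h | h
    · rw [min_eq_left h, sub_self, zero_mul]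
      positivity
    · have hmin : min (D m) (x m : ℝ) = x m := min_eq_right h.le
      have hx0 : (0 : ℝ) ≤ x m := Nat.cast_nonneg _
      have hDB := hB e D hD.1 m
      -- Truncation affects queue `m` only if it holds fewer than `B` customers. Emptying it then
      -- moves `x` by at most `B` to a point where its pressure is not positive, so its pressure at
      -- `x` is small.
      set z : Fin M → ℕ := Function.update x m 0 with hz
      have hzx : ‖countVec z - countVec x‖ ≤ B := by
        have : countVec z - countVec x = EuclideanSpace.single m (-(x m : ℝ)) := by
          ext k
          by_cases hk : k = m
          · subst hk; simp [countVec, hz]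
          · simp [countVec, hz, hk]
        rw [this, PiLp.norm_single, norm_neg, Real.norm_of_nonneg hx0]
        linarith
      have h6 := hK (countVec x) (countVec_mem_orthant x) hx (countVec z)
        (countVec_mem_orthant z) hzx
      have hs0 : (0 : Fin M → ℝ) ≤ Pi.single m 1 := by
        simp
      have h7 : pressureProd R G (countVec z) (Pi.single m 1) ≤ 0 := by
        refine horient _ (countVec_mem_orthant z) _ hs0 ?_
        simp [countVec, hz]
      have h8 : pressureProd R G (countVec x) (Pi.single m 1) ≤ C * (η * g) := by
        have h9 : pressureProd R G (countVec x) (Pi.single m 1) -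
            pressureProd R G (countVec z) (Pi.single m 1) ≤ C * (η * g) := by
          rw [pressureProd_eq_inner, pressureProd_eq_inner, ← inner_sub_left]
          refine (real_inner_le_norm _ _).trans ?_
          rw [mul_comm, norm_sub_rev]
          refine mul_le_mul (hC _ hs0 fun k => ?_) h6 (norm_nonneg _) hC0.le
          by_cases hk : k = m
          · subst hk; simp
          · simp [hk]
        linarith
      rw [hmin]
      calc (D m - x m) * pressureProd R G (countVec x) (Pi.single m 1)
          ≤ (D m - x m) * (C * (η * g)) := by
            gcongr
        _ ≤ B * (C * (η * g)) := by
            gcongr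
            linarith
  have h6 := Finset.sum_le_sum fun m (_ : m ∈ Finset.univ) => h5 m
  rw [Finset.sum_const, Finset.card_univ, Fintype.card_fin, nsmul_eq_mul] at h6
  have h7 : (M : ℝ) * (B * (C * (η * g))) ≤ ε * g := by
    have h8 : (M * B * C) * η ≤ ε := by
      rw [hη, mul_div_assoc', div_le_iff₀ (by positivity)]
      nlinarith
    calc (M : ℝ) * (B * (C * (η * g))) = (M * B * C) * η * g := by ring
      _ ≤ ε * g := mul_le_mul_of_nonneg_right h8 (norm_nonneg _)
  rw [h1, h3]
  linarith

end

/-! ### Slack of admissible arrivals -/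

section
variable {M : ℕ} {SD : Type*} [Fintype SD] {R : Matrix (Fin M) (Fin M) ℝ}
  {G : EuclideanSpace ℝ (Fin M) → ℝ} {region feasible : SD → Set (Fin M → ℝ)}

lemma IsAdmissibleRate.region_nonempty {πD : PMF SD} {L : Fin M → ℝ}
    (hadm : IsAdmissibleRate R πD region L) (e : SD) : (region e).Nonempty := by
  obtain ⟨D, hD, -⟩ := mem_of_mem_nhdsWithin (show workload R L ∈ Set.Ici 0 from hadm.1) hadm.2
  exact ⟨D e, hD e⟩

/-- `1 - R` is invertible because `R` is nilpotent. Hence the pressure paired with the workload is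
the gradient paired with the arrival rate. -/
lemma vecMul_workload (hR : IsRoutingMatrix R) (L : Fin M → ℝ) :
    Matrix.vecMul (workload R L) (1 - R) = L := by
  have h : IsUnit (1 - R).det :=
    (Matrix.isUnit_iff_isUnit_det _).1 hR.acyclic.isUnit_one_sub
  rw [workload, Matrix.vecMul_vecMul, Matrix.nonsing_inv_mul _ h, Matrix.vecMul_one]

/-- For admissible arrivals, the average maximal pressure exceeds the average growth due to
arrivals by a positive multiple of the norm of the gradient. -/
lemma IsAdmissibleRate.exists_slack (hR : IsRoutingMatrix R)
    (hserv : IsServiceModel region feasible) {πD : PMF SD} {L : Fin M → ℝ}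
    (hadm : IsAdmissibleRate R πD region L)
    (hpos : ∃ c : ℝ, 0 < c ∧ ∀ᶠ x in atInftyOrthant M, ∃ D : Fin M → ℝ,
      0 ≤ D ∧ D ≤ 1 ∧ c * ‖grad G x‖ ≤ pressureProd R G x D) :
    ∃ δ > 0, ∃ K : ℝ, ∀ x ∈ orthant M, K ≤ ‖x‖ →
      ∑ m, grad G x m * L m + δ * ‖grad G x‖ ≤ pmfMean πD (maxPressure R G region x) := by
  obtain ⟨c, hc, hev⟩ := hpos
  obtain ⟨K, hK⟩ := eventually_atInftyOrthant.1 hev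
  obtain ⟨η, hη, hsub⟩ := Metric.mem_nhdsWithin_iff.1 hadm.2
  refine ⟨η / 2 * c, by positivity, K, fun x hx hxK => ?_⟩
  obtain ⟨D, hD0, hD1, hDc⟩ := hK x hx hxK
  -- As `0 ≤ D ≤ 1`, the shifted workload stays in the orthant and within distance `η`, so it is
  -- still sustainable; its excess pressure is the slack.
  have hmem : workload R L + (η / 2) • D ∈ sustainableWorkloads πD region := by
    refine hsub ⟨?_, ?_⟩
    · rw [Metric.mem_ball, dist_eq_norm, add_sub_cancel_left, norm_smul,
        Real.norm_of_nonneg (by positivity)]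
      have : ‖D‖ ≤ 1 := by
        refine (pi_norm_le_iff_of_nonneg zero_le_one).2 fun m => ?_
        rw [Real.norm_of_nonneg (hD0 m)]
        exact hD1 m
      nlinarith
    · exact add_nonneg hadm.1 (smul_nonneg (by positivity) hD0)
  obtain ⟨F, hF, hFe⟩ := hmem
  have h1 : pressureProd R G x (workload R L) = ∑ m, grad G x m * L m := by
    rw [pressureProd_eq_inner, netDeparture, vecMul_workload hR, PiLp.inner_apply]
    exact Finset.sum_congr rfl fun m _ => by simp [mul_comm]
  have h2 := congrArg (pressureLin R G x) hFe
  simp only [map_add, map_sum, map_smul, pressureLin_apply, smul_eq_mul] at h2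
  rw [h1] at h2
  have h3 : ∑ e, (πD e).toReal * pressureProd R G x (F e) ≤
      pmfMean πD (maxPressure R G region x) := by
    rw [pmfMean, tsum_fintype]
    exact Finset.sum_le_sum fun e _ => mul_le_mul_of_nonneg_left
      (hserv.pressureProd_le x (hF e)) ENNReal.toReal_nonneg
  have h4 : η / 2 * (c * ‖grad G x‖) ≤ η / 2 * pressureProd R G x D := by gcongr
  linarith

end

/-! ### The corrections for the modulating chains -/

/-- The average arrivals in the modulating state `s`. -/
def arrivalMean {M : ℕ} {SA : Type*} (arr : SA → PMF (Fin M → ℕ)) (s : SA) (m : Fin M) : ℝ :=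
  pmfMean (arr s) fun a => (a m : ℝ)

/-- A correction of the potential that averages the arrivals over their modulating chain. -/
lemma exists_arrival_correction {M : ℕ} {SA : Type*} [Fintype SA]
    (G : EuclideanSpace ℝ (Fin M) → ℝ) {PA : SA → PMF SA} (hPA : IsIrreducibleChain PA)
    {πA : PMF SA} (hπA : IsStationaryFor PA πA) (arr : SA → PMF (Fin M → ℕ)) :
    ∃ (q : EuclideanSpace ℝ (Fin M) → SA → ℝ) (C : ℝ), 0 ≤ C ∧
      (∀ x s, |q x s| ≤ C * ‖grad G x‖) ∧
      (∀ x z s, q z s - q x s ≤ C * ‖grad G z - grad G x‖) ∧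
      ∀ x s, pmfMean (PA s) (q x) - q x s =
        ∑ m, grad G x m * arrivalRate πA arr m - ∑ m, grad G x m * arrivalMean arr s m := by
  have h : ∀ m, ∃ c : SA → ℝ, ∀ s, c s - pmfMean (PA s) c =
      arrivalMean arr s m + - arrivalRate πA arr m := by
    intro m
    refine hPA.exists_poisson hπA _ ?_
    rw [pmfMean_add _ (Set.toFinite _), pmfMean_const, pmfMean, tsum_fintype]
    simp [arrivalRate, arrivalMean, pmfMean]
  choose c hc using h
  let w : SA → EuclideanSpace ℝ (Fin M) := fun s => WithLp.toLp 2 fun m => c m s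
  have hw : ∀ (y : EuclideanSpace ℝ (Fin M)) s, inner ℝ y (w s) = ∑ m, y m * c m s := by
    intro y s
    rw [PiLp.inner_apply]
    exact Finset.sum_congr rfl fun m _ => by simp [w, mul_comm]
  obtain ⟨C, hC⟩ := (Set.finite_range fun s => ‖w s‖).bddAbove
  have hCw : ∀ s, ‖w s‖ ≤ max C 0 := fun s => (hC ⟨s, rfl⟩).trans (le_max_left _ _)
  refine ⟨fun x s => inner ℝ (grad G x) (w s), max C 0, le_max_right _ _, ?_, ?_, ?_⟩
  · intro x s
    refine (abs_real_inner_le_norm _ _).trans ?_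
    rw [mul_comm]
    exact mul_le_mul_of_nonneg_right (hCw s) (norm_nonneg _)
  · intro x z s
    rw [← inner_sub_left]
    refine (real_inner_le_norm _ _).trans ?_
    rw [mul_comm]
    exact mul_le_mul_of_nonneg_right (hCw s) (norm_nonneg _)
  · intro x s
    simp only [hw]
    rw [pmfMean_finset_sum _ (Set.toFinite _), ← Finset.sum_sub_distrib,
      ← Finset.sum_sub_distrib]
    refine Finset.sum_congr rfl fun m _ => ?_
    rw [pmfMean_const_mul]
    linear_combination - grad G x m * hc m s

/-- A correction of the potential that averages the maximal pressures over the environment. -/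
lemma exists_service_correction {M : ℕ} {SD : Type*} [Fintype SD]
    {R : Matrix (Fin M) (Fin M) ℝ} {region feasible : SD → Set (Fin M → ℝ)}
    (G : EuclideanSpace ℝ (Fin M) → ℝ) (hserv : IsServiceModel region feasible)
    (hne : ∀ e, (region e).Nonempty) {PD : SD → PMF SD} (hPD : IsIrreducibleChain PD)
    {πD : PMF SD} (hπD : IsStationaryFor PD πD) :
    ∃ (q : EuclideanSpace ℝ (Fin M) → SD → ℝ) (C : ℝ), 0 ≤ C ∧
      (∀ x e, |q x e| ≤ C * ‖grad G x‖) ∧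
      (∀ x z e, q z e - q x e ≤ C * ‖grad G z - grad G x‖) ∧
      ∀ x e, pmfMean (PD e) (q x) - q x e =
        maxPressure R G region x e - pmfMean πD (maxPressure R G region x) := by
  obtain ⟨B, -, hB⟩ := hserv.exists_bound
  obtain ⟨C, hC0, hC⟩ := exists_norm_netDeparture_le R B
  have hC' : ∀ e, ∀ D ∈ region e, ‖netDeparture R D‖ ≤ C := fun e D hD =>
    hC D (hserv.nonneg e D hD) (hB e D hD)
  obtain ⟨Z, hZ⟩ := hPD.exists_poisson_kernel hπD
  obtain ⟨b, hb⟩ := (Set.finite_range fun e => ∑ u, |Z e u|).bddAbove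
  have hbZ : ∀ e, ∑ u, |Z e u| ≤ max b 0 := fun e => (hb ⟨e, rfl⟩).trans (le_max_left _ _)
  have hsum : ∀ (e : SD) (f : SD → ℝ) (a : ℝ), 0 ≤ a → (∀ u, |f u| ≤ C * a) →
      |∑ u, Z e u * f u| ≤ max b 0 * C * a := by
    intro e f a ha hf
    calc |∑ u, Z e u * f u| ≤ ∑ u, |Z e u * f u| := Finset.abs_sum_le_sum_abs _ _
      _ ≤ ∑ u, |Z e u| * (C * a) := Finset.sum_le_sum fun u _ => by
          rw [abs_mul]
          exact mul_le_mul_of_nonneg_left (hf u) (abs_nonneg _)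
      _ = (∑ u, |Z e u|) * (C * a) := by rw [Finset.sum_mul]
      _ ≤ max b 0 * (C * a) := mul_le_mul_of_nonneg_right (hbZ e) (by positivity)
      _ = _ := by ring
  refine ⟨fun x e => (-1) * ∑ u, Z e u * maxPressure R G region x u, max b 0 * C,
    by positivity, ?_, ?_, ?_⟩
  · intro x e
    change |(-1) * ∑ u, Z e u * maxPressure R G region x u| ≤ _
    rw [neg_one_mul, abs_neg]
    exact hsum e _ _ (norm_nonneg _) fun u => hserv.abs_maxPressure_le hC' u (hne u) x
  · intro x z e
    have h1 : (-1) * ∑ u, Z e u * maxPressure R G region z u -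
        (-1) * ∑ u, Z e u * maxPressure R G region x u =
        ∑ u, Z e u * (maxPressure R G region x u - maxPressure R G region z u) := by
      simp only [mul_sub, Finset.sum_sub_distrib]
      ring
    rw [h1, norm_sub_rev]
    exact (le_abs_self _).trans (hsum e _ _ (norm_nonneg _) fun u =>
      hserv.maxPressure_sub_le hC' u (hne u) z x)
  · intro x e
    rw [pmfMean_const_mul]
    linear_combination hZ (maxPressure R G region x) e

/-! ### The drift condition -/

/-- The increments of the queue lengths are bounded. -/
lemma IsServiceModel.exists_increment_bound {M : ℕ} {SD : Type*} [Fintype SD]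
    {region feasible : SD → Set (Fin M → ℝ)} (hserv : IsServiceModel region feasible)
    (R : Matrix (Fin M) (Fin M) ℝ) (G : EuclideanSpace ℝ (Fin M) → ℝ) (N : ℕ) :
    ∃ r : ℝ, 0 < r ∧ ∀ (a : Fin M → ℕ) e d (z x : Fin M → ℕ), (∀ m, a m ≤ N) →
      IsMaxScalarChoice R G feasible e x d →
      countVec z = countVec x + countVec a - netDeparture R d →
      ‖countVec z - countVec x‖ ≤ r := by
  obtain ⟨B, -, hB⟩ := hserv.exists_bound
  obtain ⟨C, hC0, hC⟩ := exists_norm_netDeparture_le R B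
  refine ⟨N * M + C, by positivity, fun a e d z x ha hd hz => ?_⟩
  have hsub : countVec z - countVec x = countVec a - netDeparture R d := by
    rw [hz]; abel
  have hdr := hserv.feasible_subset e hd.1.1
  have hca : ‖countVec a‖ ≤ N * M := by
    have h1 : ‖countVec a‖ ≤ ∑ m, ‖(a m : ℝ)‖ := by
      have h2 : countVec a = ∑ m, EuclideanSpace.single m (a m : ℝ) := by
        ext k
        simp [countVec, Finset.sum_apply]
      rw [h2]
      refine (norm_sum_le _ _).trans (le_of_eq ?_)
      exact Finset.sum_congr rfl fun m _ => PiLp.norm_single _ _ _ _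
    refine h1.trans ((Finset.sum_le_sum (g := fun _ => (N : ℝ)) fun m _ => ?_).trans ?_)
    · rw [Real.norm_of_nonneg (Nat.cast_nonneg _)]
      exact_mod_cast ha m
    · simp [mul_comm]
  rw [hsub]
  refine (norm_sub_le _ _).trans (add_le_add hca ?_)
  exact hC d (hserv.nonneg e d hdr) (hB e d hdr)

/-- A nonnegative potential of the Markov chain `(X, sA, sD)` with negative drift outside of a
bounded set. -/
lemma exists_drift_potential {M : ℕ} {SA SD : Type*} [Fintype SA] [Fintype SD]
    {R : Matrix (Fin M) (Fin M) ℝ} (hR : IsRoutingMatrix R)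
    {region feasible : SD → Set (Fin M → ℝ)} (hserv : IsServiceModel region feasible)
    {PA : SA → PMF SA} (hPA : IsIrreducibleChain PA)
    {PD : SD → PMF SD} (hPD : IsIrreducibleChain PD)
    {πA : PMF SA} (hπA : IsStationaryFor PA πA) {πD : PMF SD} (hπD : IsStationaryFor PD πD)
    (arr : SA → PMF (Fin M → ℕ)) (N : ℕ)
    (hadm : IsAdmissibleRate R πD region (arrivalRate πA arr))
    {G : EuclideanSpace ℝ (Fin M) → ℝ} (hG : IsStrongPotential R G)
    (hsmall : ∀ ε > 0, ∃ K : ℝ, ∀ x ∈ orthant M, K ≤ ‖x‖ → ‖grad G x‖ ≤ ε * |G x|)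
    (hgrad : ∀ r > 0, ∀ ε > 0, ∃ K : ℝ, ∀ x ∈ orthant M, K ≤ ‖x‖ → ∀ z ∈ orthant M,
      ‖z - x‖ ≤ r → ‖grad G z - grad G x‖ ≤ ε * ‖grad G x‖) :
    ∃ (V : (Fin M → ℕ) → SA → SD → ℝ) (δ b K : ℝ), 0 < δ ∧
      (∀ x s e, 0 ≤ V x s e) ∧ (∀ x s e, V x s e ≤ 2 * |G (countVec x)| + b) ∧
      ∀ x, K ≤ ‖countVec x‖ → ∀ s e, ∃ (β : ℝ) (ψA : SA → ℝ) (ψD : SD → ℝ),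
        (∀ (a : Fin M → ℕ) d s' e' z, (∀ m, a m ≤ N) → IsMaxScalarChoice R G feasible e x d →
          countVec z = countVec x + countVec a - netDeparture R d →
          V z s' e' ≤ ∑ m, grad G (countVec x) m * a m + (ψA s' + (ψD e' + β))) ∧
        ∑ m, grad G (countVec x) m * arrivalMean arr s m + (pmfMean (PA s) ψA +
          (pmfMean (PD e) ψD + β)) + δ * ‖grad G (countVec x)‖ ≤ V x s e := by
  have hne := hadm.region_nonempty
  obtain ⟨qA, CA, hCA, hA1, hA2, hA3⟩ := exists_arrival_correction G hPA hπA arr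
  obtain ⟨qD, CD, hCD, hD1, hD2, hD3⟩ :=
    exists_service_correction (R := R) G hserv hne hPD hπD
  obtain ⟨δ, hδ, K₁, hK₁⟩ := hadm.exists_slack (G := G) hR hserv hG.positivity
  obtain ⟨K₂, hK₂⟩ := hserv.maxPressure_le_choice hne hG.orientation hgrad (δ / 4)
    (by positivity)
  obtain ⟨r, hr0, hrle⟩ := hserv.exists_increment_bound R G N
  -- The slack `δ` is shared out: `δ / 4` for the truncation error of the policy, `δ / 4` for the
  -- Taylor remainder and the variation of both corrections, and `δ / 2` for the final drift.
  set ε : ℝ := δ / (4 * (r + CA + CD)) with hε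
  have hε0 : 0 < ε := by positivity
  have hεle : r * ε + CA * ε + CD * ε = δ / 4 := by
    rw [hε]
    field_simp
  obtain ⟨K₃, hK₃⟩ := hgrad r hr0 ε hε0
  -- positivity of the potential near infinity
  obtain ⟨K₄, hK₄⟩ := hsmall (1 / (CA + CD + 1)) (by positivity)
  obtain ⟨K₅, hK₅⟩ := eventually_atInftyOrthant.1 (hG.superlinear.eventually_ge_atTop 0)
  have hcorr : ∀ x s e, |qA x s + qD x e| ≤ (CA + CD) * ‖grad G x‖ := fun x s e =>
    (abs_add_le _ _).trans (by linarith [hA1 x s, hD1 x e])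
  have hcorr' : ∀ x ∈ orthant M, K₄ ≤ ‖x‖ → ∀ s e, |qA x s + qD x e| ≤ |G x| := by
    intro x hx hxK s e
    refine (hcorr x s e).trans ?_
    have h1 := hK₄ x hx hxK
    calc (CA + CD) * ‖grad G x‖ ≤ (CA + CD + 1) * (1 / (CA + CD + 1) * |G x|) :=
          mul_le_mul (by linarith) h1 (norm_nonneg _) (by positivity)
      _ = |G x| := by field_simp
  set K₆ := max (max K₄ K₅) 1 with hK₆
  have hGnn : ∀ x ∈ orthant M, K₆ ≤ ‖x‖ → 0 ≤ G x := by
    intro x hx hxK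
    simp only [hK₆, max_le_iff] at hxK
    have h1 := hK₅ x hx hxK.1.2
    have h2 : 0 < ‖x‖ := by linarith
    have h3 := mul_nonneg h1 h2.le
    rwa [div_mul_cancel₀ _ h2.ne'] at h3
  -- The shift `b₀` restores nonnegativity on the bounded part; beyond `K₆`, `G` is nonnegative and
  -- dominates the corrections.
  obtain ⟨b₀, hb₀, hb⟩ := exists_le_countVec (fun x : Fin M → ℕ =>
    |G (countVec x)| + (CA + CD) * ‖grad G (countVec x)‖) K₆
  refine ⟨fun x s e => G (countVec x) + (qA (countVec x) s + qD (countVec x) e) + b₀, δ / 2,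
    2 * b₀, max K₁ (max K₂ K₃), by positivity, ?_, ?_, ?_⟩
  · intro x s e
    change 0 ≤ G (countVec x) + (qA (countVec x) s + qD (countVec x) e) + b₀
    rcases lt_or_ge ‖countVec x‖ K₆ with h | h
    · have h1 := hb x h
      have h2 := neg_le_of_abs_le (hcorr (countVec x) s e)
      have h3 := neg_abs_le (G (countVec x))
      linarith
    · have h1 := hGnn _ (countVec_mem_orthant x) h
      have h2 := neg_le_of_abs_le (hcorr' _ (countVec_mem_orthant x)
        (((le_max_left _ _).trans (le_max_left _ _)).trans h) s e)
      rw [abs_of_nonneg h1] at h2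
      linarith
  · intro x s e
    change G (countVec x) + (qA (countVec x) s + qD (countVec x) e) + b₀ ≤ _
    rcases lt_or_ge ‖countVec x‖ K₆ with h | h
    · have h1 := hb x h
      have h2 := le_of_abs_le (hcorr (countVec x) s e)
      have h3 := le_abs_self (G (countVec x))
      have h4 := abs_nonneg (G (countVec x))
      linarith
    · have h2 := le_of_abs_le (hcorr' _ (countVec_mem_orthant x)
        (((le_max_left _ _).trans (le_max_left _ _)).trans h) s e)
      have h3 := le_abs_self (G (countVec x))
      linarith
  · intro x hx s e
    simp only [max_le_iff] at hx
    have hxo := countVec_mem_orthant x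
    set g := ‖grad G (countVec x)‖ with hg
    -- The departures are eliminated through the maximal pressure. What remains is a sum of
    -- functions of the arrivals and of each new modulating state, which can be averaged separately.
    refine ⟨G (countVec x) + b₀ - maxPressure R G region (countVec x) e + δ / 2 * g,
      qA (countVec x), qD (countVec x), ?_, ?_⟩
    · intro a d s' e' z ha hd hz
      change G (countVec z) + (qA (countVec z) s' + qD (countVec z) e') + b₀ ≤ _
      have hzo := countVec_mem_orthant z
      have hsub : countVec z - countVec x = countVec a - netDeparture R d := by
        rw [hz]; abel
      have hzr := hrle a e d z x ha hd hz
      have h1 := sub_sub_inner_grad_le hG.smooth hxo hzo hzr (hK₃ _ hxo hx.2.2)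
      have h2 := hK₃ _ hxo hx.2.2 _ hzo hzr
      have h3 := (hA2 (countVec x) (countVec z) s').trans (mul_le_mul_of_nonneg_left h2 hCA)
      have h4 := (hD2 (countVec x) (countVec z) e').trans (mul_le_mul_of_nonneg_left h2 hCD)
      have h5 := hK₂ x hx.2.1 e d hd
      rw [hsub, inner_sub_right, ← pressureProd_eq_inner] at h1
      have h6 : inner ℝ (grad G (countVec x)) (countVec a) =
          ∑ m, grad G (countVec x) m * a m := by
        rw [PiLp.inner_apply]
        exact Finset.sum_congr rfl fun m _ => by simp [countVec, mul_comm]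
      rw [h6] at h1
      have h7 : (r * ε + CA * ε + CD * ε) * g = δ / 4 * g := by rw [hεle]
      linarith
    · have h1 := hA3 (countVec x) s
      have h2 := hD3 (countVec x) e
      have h3 := hK₁ _ hxo hx.1
      linarith

/-! ### The transition operator -/

lemma tsum_pmf_mul_le {β : Type*} (p : PMF β) (φ : β → ENNReal) (c : ENNReal)
    (h : ∀ b, p b ≠ 0 → φ b ≤ c) : ∑' b, p b * φ b ≤ c := by
  calc ∑' b, p b * φ b ≤ ∑' b, p b * c := by
        refine ENNReal.tsum_le_tsum fun b => ?_
        by_cases hb : p b = 0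
        · simp [hb]
        · exact mul_le_mul_right (h b hb) _
    _ = c := by rw [ENNReal.tsum_mul_right, p.tsum_coe, one_mul]

lemma tsum_pmf_mul_le_ofReal {β : Type*} (p : PMF β) (hp : p.support.Finite) (φ : β → ENNReal)
    (ψ : β → ℝ) (h0 : ∀ b, p b ≠ 0 → 0 ≤ ψ b) (h : ∀ b, p b ≠ 0 → φ b ≤ ENNReal.ofReal (ψ b)) :
    ∑' b, p b * φ b ≤ ENNReal.ofReal (pmfMean p ψ) := by
  rw [← tsum_pmf_mul_ofReal p hp ψ h0]
  refine ENNReal.tsum_le_tsum fun b => ?_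
  by_cases hb : p b = 0
  · simp [hb]
  · exact mul_le_mul_right (h b hb) _

lemma tsum_four_pmf {α β γ δ : Type*} (p : PMF α) (q : PMF β) (r : PMF γ) (s : PMF δ)
    (φ : α × β × γ × δ → ENNReal) :
    ∑' i : α × β × γ × δ, p i.1 * q i.2.1 * r i.2.2.1 * s i.2.2.2 * φ i =
      ∑' a, p a * ∑' b, q b * ∑' c, r c * ∑' d, s d * φ (a, b, c, d) := by
  simp only [ENNReal.tsum_prod', ← ENNReal.tsum_mul_left, mul_assoc]

lemma tsum_four_pmf_le {α β γ δ : Type*} (p : PMF α) (q : PMF β) (r : PMF γ) (s : PMF δ)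
    (φ : α × β × γ × δ → ENNReal) (c : ENNReal)
    (h : ∀ i, p i.1 * q i.2.1 * r i.2.2.1 * s i.2.2.2 ≠ 0 → φ i ≤ c) :
    ∑' i : α × β × γ × δ, p i.1 * q i.2.1 * r i.2.2.1 * s i.2.2.2 * φ i ≤ c := by
  rw [tsum_four_pmf]
  refine tsum_pmf_mul_le p _ c fun a ha => tsum_pmf_mul_le q _ c fun b hb =>
    tsum_pmf_mul_le r _ c fun x hx => tsum_pmf_mul_le s _ c fun y hy => ?_
  exact h (a, b, x, y) (by simp [ha, hb, hx, hy])

/-- Only the sum of the three functions is known to be nonnegative, not each term, so coordinates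
are averaged one at a time and each partial mean is shown to be nonnegative. The bound does not
involve the second coordinate, so `q` may have infinite support. -/
lemma tsum_four_pmf_le_ofReal {α β γ δ : Type*} (p : PMF α) (hp : p.support.Finite) (q : PMF β)
    (r : PMF γ) (hr : r.support.Finite) (s : PMF δ) (hs : s.support.Finite)
    (φ : α × β × γ × δ → ENNReal) (ψ₁ : α → ℝ) (ψ₂ : γ → ℝ) (ψ₃ : δ → ℝ)
    (h0 : ∀ i : α × β × γ × δ, p i.1 * q i.2.1 * r i.2.2.1 * s i.2.2.2 ≠ 0 →
      0 ≤ ψ₁ i.1 + (ψ₂ i.2.2.1 + ψ₃ i.2.2.2))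
    (h : ∀ i, p i.1 * q i.2.1 * r i.2.2.1 * s i.2.2.2 ≠ 0 →
      φ i ≤ ENNReal.ofReal (ψ₁ i.1 + (ψ₂ i.2.2.1 + ψ₃ i.2.2.2))) :
    0 ≤ pmfMean p ψ₁ + (pmfMean r ψ₂ + pmfMean s ψ₃) ∧
    ∑' i : α × β × γ × δ, p i.1 * q i.2.1 * r i.2.2.1 * s i.2.2.2 * φ i ≤
      ENNReal.ofReal (pmfMean p ψ₁ + (pmfMean r ψ₂ + pmfMean s ψ₃)) := by
  obtain ⟨b₀, hb₀⟩ := q.support_nonempty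
  rw [PMF.mem_support_iff] at hb₀
  have e1 : ∀ a c, pmfMean s (fun d => ψ₁ a + (ψ₂ c + ψ₃ d)) =
      ψ₁ a + (ψ₂ c + pmfMean s ψ₃) := by
    intro a c
    rw [pmfMean_add _ hs, pmfMean_add _ hs, pmfMean_const, pmfMean_const]
  have e2 : ∀ a, pmfMean r (fun c => ψ₁ a + (ψ₂ c + pmfMean s ψ₃)) =
      ψ₁ a + (pmfMean r ψ₂ + pmfMean s ψ₃) := by
    intro a
    rw [pmfMean_add _ hr, pmfMean_add _ hr, pmfMean_const, pmfMean_const]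
  have e3 : pmfMean p (fun a => ψ₁ a + (pmfMean r ψ₂ + pmfMean s ψ₃)) =
      pmfMean p ψ₁ + (pmfMean r ψ₂ + pmfMean s ψ₃) := by
    rw [pmfMean_add _ hp, pmfMean_const]
  have n1 : ∀ a, p a ≠ 0 → ∀ c, r c ≠ 0 → 0 ≤ ψ₁ a + (ψ₂ c + pmfMean s ψ₃) := by
    intro a ha c hc
    rw [← e1]
    exact pmfMean_nonneg _ _ fun d hd => h0 (a, b₀, c, d)
      (by simp [ha, hb₀, hc, (PMF.mem_support_iff _ _).1 hd])
  have n2 : ∀ a, p a ≠ 0 → 0 ≤ ψ₁ a + (pmfMean r ψ₂ + pmfMean s ψ₃) := by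
    intro a ha
    rw [← e2]
    exact pmfMean_nonneg _ _ fun c hc => n1 a ha c hc
  refine ⟨?_, ?_⟩
  · rw [← e3]
    exact pmfMean_nonneg _ _ fun a ha => n2 a ha
  · rw [tsum_four_pmf, ← e3]
    refine tsum_pmf_mul_le_ofReal p hp _ _ n2 fun a ha => ?_
    refine tsum_pmf_mul_le q _ _ fun b hb => ?_
    rw [← e2]
    refine tsum_pmf_mul_le_ofReal r hr _ _ (n1 a ha) fun c hc => ?_
    rw [← e1]
    exact tsum_pmf_mul_le_ofReal s hs _ _
      (fun d hd => h0 (a, b, c, d) (by simp [ha, hb, hc, hd]))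
      (fun d hd => h (a, b, c, d) (by simp [ha, hb, hc, hd]))

/-- The state that follows `y` after arrivals, departures and moves of the modulating chains
given by `i`. -/
def nextState {M : ℕ} {SA SD : Type*} (R : Matrix (Fin M) (Fin M) ℝ)
    (y : (Fin M → ℕ) × SA × SD) (i : (Fin M → ℕ) × (Fin M → ℝ) × SA × SD) :
    (Fin M → ℕ) × SA × SD :=
  (fun m => ⌊(y.1 m : ℝ) + i.1 m - Matrix.vecMul i.2.1 (1 - R) m⌋₊, i.2.2.1, i.2.2.2)

/-- The transition operator of the Markov chain `(X, sA, sD)`. -/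
def transitionOp {M : ℕ} {SA SD : Type*} (R : Matrix (Fin M) (Fin M) ℝ) (PA : SA → PMF SA)
    (PD : SD → PMF SD) (arr : SA → PMF (Fin M → ℕ))
    (pol : (Fin M → ℕ) → SA → SD → PMF (Fin M → ℝ)) (φ : (Fin M → ℕ) × SA × SD → ENNReal)
    (y : (Fin M → ℕ) × SA × SD) : ENNReal :=
  ∑' i : (Fin M → ℕ) × (Fin M → ℝ) × SA × SD,
    arr y.2.1 i.1 * pol y.1 y.2.1 y.2.2 i.2.1 * PA y.2.1 i.2.2.1 * PD y.2.2 i.2.2.2 *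
      φ (nextState R y i)

/-! ### The queue process as a Markov chain -/

section
variable {M : ℕ} {SA SD Ω : Type*} {mΩ : MeasurableSpace Ω} {μ : Measure Ω}
  {R : Matrix (Fin M) (Fin M) ℝ} {PA : SA → PMF SA} {PD : SD → PMF SD}
  {arr : SA → PMF (Fin M → ℕ)} {pol : (Fin M → ℕ) → SA → SD → PMF (Fin M → ℝ)}
  {ℱ : Filtration ℕ mΩ} {X : ℕ → Ω → Fin M → ℕ} {sA : ℕ → Ω → SA} {sD : ℕ → Ω → SD}
  {A : ℕ → Ω → Fin M → ℕ} {D : ℕ → Ω → Fin M → ℝ}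

lemma IsQueueProcess.measurableSet_state (hproc : IsQueueProcess μ R PA PD arr pol ℱ X sA sD A D)
    (t : ℕ) (y : (Fin M → ℕ) × SA × SD) :
    MeasurableSet {ω | (X t ω, sA t ω, sD t ω) = y} := by
  have : {ω | (X t ω, sA t ω, sD t ω) = y} =
      {ω | X t ω = y.1} ∩ ({ω | sA t ω = y.2.1} ∩ {ω | sD t ω = y.2.2}) := by
    ext ω
    simp [Prod.ext_iff]
  rw [this]
  exact (ℱ.le t _ (hproc.measurable_X t _)).inter
    ((ℱ.le t _ (hproc.measurable_sA t _)).inter (ℱ.le t _ (hproc.measurable_sD t _)))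

/-- The joint law of the state and of the transition that follows. -/
lemma IsQueueProcess.measure_transition
    (hproc : IsQueueProcess μ R PA PD arr pol ℱ X sA sD A D) (t : ℕ)
    (b : ((Fin M → ℕ) × SA × SD) × ((Fin M → ℕ) × (Fin M → ℝ) × SA × SD)) :
    μ {ω | ((X t ω, sA t ω, sD t ω), (A t ω, D t ω, sA (t + 1) ω, sD (t + 1) ω)) = b} =
      μ {ω | (X t ω, sA t ω, sD t ω) = b.1} *
        (arr b.1.2.1 b.2.1 * pol b.1.1 b.1.2.1 b.1.2.2 b.2.2.1 * PA b.1.2.1 b.2.2.2.1 *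
          PD b.1.2.2 b.2.2.2.2) := by
  obtain ⟨⟨x, s, e⟩, a, d, s', e'⟩ := b
  have := hproc.law t Set.univ MeasurableSet.univ x s e a d s' e'
  rw [Set.univ_inter] at this
  simp only [Prod.mk.injEq]
  rw [← this]
  rfl

lemma IsQueueProcess.measurableSet_transition
    (hproc : IsQueueProcess μ R PA PD arr pol ℱ X sA sD A D) (t : ℕ)
    (b : ((Fin M → ℕ) × SA × SD) × ((Fin M → ℕ) × (Fin M → ℝ) × SA × SD)) :
    MeasurableSet
      {ω | ((X t ω, sA t ω, sD t ω), (A t ω, D t ω, sA (t + 1) ω, sD (t + 1) ω)) = b} := by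
  have : {ω | ((X t ω, sA t ω, sD t ω), (A t ω, D t ω, sA (t + 1) ω, sD (t + 1) ω)) = b} =
      {ω | (X t ω, sA t ω, sD t ω) = b.1} ∩ (A t ⁻¹' {b.2.1} ∩ (D t ⁻¹' {b.2.2.1} ∩
        ({ω | sA (t + 1) ω = b.2.2.2.1} ∩ {ω | sD (t + 1) ω = b.2.2.2.2}))) := by
    ext ω
    simp [Prod.ext_iff]
  rw [this]
  exact (hproc.measurableSet_state t _).inter
    ((hproc.measurable_A t (measurableSet_singleton _)).inter
      ((hproc.measurable_D t (measurableSet_singleton _)).inter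
        ((ℱ.le _ _ (hproc.measurable_sA _ _)).inter (ℱ.le _ _ (hproc.measurable_sD _ _)))))

lemma IsQueueProcess.ae_nextState (hproc : IsQueueProcess μ R PA PD arr pol ℱ X sA sD A D)
    (t : ℕ) : ∀ᵐ ω ∂μ, (X (t + 1) ω, sA (t + 1) ω, sD (t + 1) ω) =
      nextState R (X t ω, sA t ω, sD t ω) (A t ω, D t ω, sA (t + 1) ω, sD (t + 1) ω) := by
  filter_upwards [hproc.evolution t] with ω h
  simp only [nextState, Prod.mk.injEq, and_true]
  funext m
  -- The floor in `nextState` loses nothing here: its argument is the natural number `X (t + 1) ω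
  -- m`.
  rw [← h m, Nat.floor_natCast]

/-- A transition of positive probability from a state that is reached with positive probability
is realized by some trajectory. -/
lemma IsQueueProcess.exists_transition
    (hproc : IsQueueProcess μ R PA PD arr pol ℱ X sA sD A D) {t : ℕ}
    {y : (Fin M → ℕ) × SA × SD} (hy : μ {ω | (X t ω, sA t ω, sD t ω) = y} ≠ 0)
    {i : (Fin M → ℕ) × (Fin M → ℝ) × SA × SD}
    (hi : arr y.2.1 i.1 * pol y.1 y.2.1 y.2.2 i.2.1 * PA y.2.1 i.2.2.1 * PD y.2.2 i.2.2.2 ≠ 0) :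
    μ {ω | (X (t + 1) ω, sA (t + 1) ω, sD (t + 1) ω) = nextState R y i} ≠ 0 ∧
      ∀ p : Ω → Prop, (∀ᵐ ω ∂μ, p ω) →
        ∃ ω, (X t ω, sA t ω, sD t ω) = y ∧ (A t ω, D t ω, sA (t + 1) ω, sD (t + 1) ω) = i ∧ p ω
    := by
  have h1 : μ {ω | ((X t ω, sA t ω, sD t ω), (A t ω, D t ω, sA (t + 1) ω, sD (t + 1) ω)) =
      (y, i)} ≠ 0 := by
    rw [hproc.measure_transition]
    exact mul_ne_zero hy hi
  constructor
  · intro h0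
    refine h1 (measure_mono_null_ae ?_ h0)
    filter_upwards [hproc.ae_nextState t] with ω h hω
    have h2 : (X t ω, sA t ω, sD t ω) = y := congrArg Prod.fst hω
    have h3 : (A t ω, D t ω, sA (t + 1) ω, sD (t + 1) ω) = i := congrArg Prod.snd hω
    rw [h2, h3] at h
    exact h
  · intro p hp
    by_contra! hcon
    refine h1 (measure_mono_null (fun ω hω => ?_) hp)
    exact hcon ω (congrArg Prod.fst hω) (congrArg Prod.snd hω)

variable [Fintype SA] [Fintype SD] [IsProbabilityMeasure μ]

lemma IsQueueProcess.tsum_state (hproc : IsQueueProcess μ R PA PD arr pol ℱ X sA sD A D)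
    (t : ℕ) : ∑' y, μ {ω | (X t ω, sA t ω, sD t ω) = y} = 1 := by
  rw [← measure_iUnion _ (hproc.measurableSet_state t)]
  · have : (⋃ y, {ω | (X t ω, sA t ω, sD t ω) = y}) = Set.univ :=
      Set.eq_univ_of_forall fun ω => Set.mem_iUnion.2 ⟨_, rfl⟩
    rw [this, measure_univ]
  · intro y z hyz
    exact Set.disjoint_left.2 fun ω h1 h2 => hyz (h1.symm.trans h2)

lemma IsQueueProcess.lintegral_state (hproc : IsQueueProcess μ R PA PD arr pol ℱ X sA sD A D)
    (t : ℕ) (φ : (Fin M → ℕ) × SA × SD → ENNReal) :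
    ∫⁻ ω, φ (X t ω, sA t ω, sD t ω) ∂μ = ∑' y, μ {ω | (X t ω, sA t ω, sD t ω) = y} * φ y :=
  lintegral_eq_tsum_atoms μ (fun ω => (X t ω, sA t ω, sD t ω)) (hproc.measurableSet_state t)
    (hproc.tsum_state t) _ φ (Eventually.of_forall fun _ => rfl)

/-- The Markov property of `(X, sA, sD)`. -/
lemma IsQueueProcess.expectation_succ (hproc : IsQueueProcess μ R PA PD arr pol ℱ X sA sD A D)
    (t : ℕ) (φ : (Fin M → ℕ) × SA × SD → ENNReal) :
    ∑' y, μ {ω | (X (t + 1) ω, sA (t + 1) ω, sD (t + 1) ω) = y} * φ y =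
      ∑' y, μ {ω | (X t ω, sA t ω, sD t ω) = y} * transitionOp R PA PD arr pol φ y := by
  have hsum : ∀ ψ : ((Fin M → ℕ) × SA × SD) × ((Fin M → ℕ) × (Fin M → ℝ) × SA × SD) → ENNReal,
      ∑' b, μ {ω | ((X t ω, sA t ω, sD t ω), (A t ω, D t ω, sA (t + 1) ω, sD (t + 1) ω)) = b} *
        ψ b = ∑' y : (Fin M → ℕ) × SA × SD, μ {ω | (X t ω, sA t ω, sD t ω) = y} *
          ∑' i : (Fin M → ℕ) × (Fin M → ℝ) × SA × SD, arr y.2.1 i.1 *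
            pol y.1 y.2.1 y.2.2 i.2.1 * PA y.2.1 i.2.2.1 * PD y.2.2 i.2.2.2 * ψ (y, i) := by
    intro ψ
    rw [ENNReal.tsum_prod']
    refine tsum_congr fun y => ?_
    rw [← ENNReal.tsum_mul_left]
    refine tsum_congr fun i => ?_
    rw [hproc.measure_transition, mul_assoc]
  rw [← hproc.lintegral_state (t + 1) φ]
  rw [lintegral_eq_tsum_atoms μ
    (fun ω => ((X t ω, sA t ω, sD t ω), (A t ω, D t ω, sA (t + 1) ω, sD (t + 1) ω)))
    (hproc.measurableSet_transition t) ?_ _ (fun b => φ (nextState R b.1 b.2)) ?_]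
  · exact hsum _
  -- The product form of the transition law shows that the atoms of the joint law have total mass
  -- one, although departures range over an uncountable space.
  · have h1 := hsum fun _ => 1
    simp only [mul_one] at h1
    rw [h1, ← hproc.tsum_state t]
    refine tsum_congr fun y => ?_
    have h2 := tsum_four_pmf (arr y.2.1) (pol y.1 y.2.1 y.2.2) (PA y.2.1) (PD y.2.2) fun _ => 1
    simp only [mul_one, PMF.tsum_coe] at h2
    rw [h2, mul_one]
  · filter_upwards [hproc.ae_nextState t] with ω h
    rw [h]

end

/-! ### Stability -/

lemma transitionOp_mono {M : ℕ} {SA SD : Type*} (R : Matrix (Fin M) (Fin M) ℝ) (PA : SA → PMF SA)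
    (PD : SD → PMF SD) (arr : SA → PMF (Fin M → ℕ))
    (pol : (Fin M → ℕ) → SA → SD → PMF (Fin M → ℝ)) :
    Monotone (transitionOp R PA PD arr pol) := fun _ _ h _ =>
  ENNReal.tsum_le_tsum fun _ => mul_le_mul_right (h _) _

lemma transitionOp_add {M : ℕ} {SA SD : Type*} (R : Matrix (Fin M) (Fin M) ℝ) (PA : SA → PMF SA)
    (PD : SD → PMF SD) (arr : SA → PMF (Fin M → ℕ))
    (pol : (Fin M → ℕ) → SA → SD → PMF (Fin M → ℝ)) (φ ψ : (Fin M → ℕ) × SA × SD → ENNReal) :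
    transitionOp R PA PD arr pol (φ + ψ) =
      transitionOp R PA PD arr pol φ + transitionOp R PA PD arr pol ψ := by
  funext y
  simp only [transitionOp, Pi.add_apply, mul_add, ENNReal.tsum_add]

lemma isFStable_of_le {M : ℕ} {Ω : Type*} {mΩ : MeasurableSpace Ω} (μ : Measure Ω)
    (F : EuclideanSpace ℝ (Fin M) → ℝ) (X : ℕ → Ω → Fin M → ℕ) (c : ENNReal) (hc : c ≠ ⊤)
    (h : ∀ t, ∫⁻ ω, ENNReal.ofReal (F (countVec (X t ω))) ∂μ ≤ c) : IsFStable μ F X :=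
  (limsup_le_of_le (h := Eventually.of_forall h)).trans_lt hc.lt_top

theorem mainTheorem2 {M : ℕ} {SA SD Ω : Type*} [Fintype SA] [Fintype SD]
    {mΩ : MeasurableSpace Ω} (μ : Measure Ω) [IsProbabilityMeasure μ]
    (R : Matrix (Fin M) (Fin M) ℝ) (hR : IsRoutingMatrix R)
    (region feasible : SD → Set (Fin M → ℝ)) (hserv : IsServiceModel region feasible)
    (PA : SA → PMF SA) (hPA : IsIrreducibleChain PA)
    (PD : SD → PMF SD) (hPD : IsIrreducibleChain PD)
    (πA : PMF SA) (hπA : IsStationaryFor PA πA)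
    (πD : PMF SD) (hπD : IsStationaryFor PD πD)
    (arr : SA → PMF (Fin M → ℕ))
    (harr : ∃ K : ℕ, ∀ s, ∀ a ∈ (arr s).support, ∀ m, a m ≤ K)
    (hadm : IsAdmissibleRate R πD region (arrivalRate πA arr))
    (G : EuclideanSpace ℝ (Fin M) → ℝ) (hG : IsStrongPotential R G)
    (pol : (Fin M → ℕ) → SA → SD → PMF (Fin M → ℝ))
    (ℱ : Filtration ℕ mΩ) (X : ℕ → Ω → Fin M → ℕ) (sA : ℕ → Ω → SA) (sD : ℕ → Ω → SD)
    (A : ℕ → Ω → Fin M → ℕ) (D : ℕ → Ω → Fin M → ℝ)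
    (hproc : IsQueueProcess μ R PA PD arr pol ℱ X sA sD A D)
    (hmax : ∀ t, ∀ᵐ ω ∂μ, IsMaxScalarChoice R G feasible (sD t ω) (X t ω) (D t ω))
    (hinit : Integrable (fun ω => G (countVec (X 0 ω))) μ) :
    IsFStable μ (fun x => ‖grad G x‖) X := by
  classical
  rcases hG.grad_bounded_or with ⟨c, K, hc⟩ | ⟨hsmall, h2⟩
  -- A gradient bounded near infinity is bounded on all lattice points of the orthant, whatever the
  -- dynamics.
  · obtain ⟨b, -, hb⟩ := exists_le_countVec (fun x : Fin M → ℕ => ‖grad G (countVec x)‖) K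
    refine isFStable_of_le μ _ X (ENNReal.ofReal (max b c)) ENNReal.ofReal_ne_top fun t => ?_
    calc ∫⁻ ω, ENNReal.ofReal ‖grad G (countVec (X t ω))‖ ∂μ
        ≤ ∫⁻ _, ENNReal.ofReal (max b c) ∂μ := by
          refine lintegral_mono fun ω => ENNReal.ofReal_le_ofReal ?_
          rcases lt_or_ge ‖countVec (X t ω)‖ K with h | h
          · exact (hb _ h).trans (le_max_left _ _)
          · exact (hc _ (countVec_mem_orthant _) h).trans (le_max_right _ _)
      _ = ENNReal.ofReal (max b c) := by simp
  obtain ⟨N, hN⟩ := harr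
  have hfin : ∀ s, (arr s).support.Finite := fun s =>
    (Set.finite_Iic fun _ : Fin M => N).subset fun a ha m => hN s a ha m
  obtain ⟨V, δ, b, K, hδ, hV0, hVle, hdrift⟩ := exists_drift_potential hR hserv hPA hPD hπA hπD
    arr N hadm hG hsmall fun r hr ε hε => grad_sub_le hG.smooth h2 r hr ε hε
  obtain ⟨r, -, hr⟩ := hserv.exists_increment_bound R G N
  let St := (Fin M → ℕ) × SA × SD
  let ν : ℕ → St → ENNReal := fun t y => μ {ω | (X t ω, sA t ω, sD t ω) = y}
  let Reach : St → Prop := fun y => ∃ t, ν t y ≠ 0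
  -- The policy is known to be maximal only almost surely, hence only at states reached with
  -- positive probability. The value `⊤` elsewhere makes the drift inequality trivial there.
  let W : St → ENNReal := fun y =>
    if Reach y then ENNReal.ofReal (V y.1 y.2.1 y.2.2) else ⊤
  let f : St → ENNReal := fun y => ENNReal.ofReal (δ * ‖grad G (countVec y.1)‖)
  let T := transitionOp (SA := SA) (SD := SD) R PA PD arr pol
  have hstep : ∀ y : St, Reach y → ∀ i : (Fin M → ℕ) × (Fin M → ℝ) × SA × SD,
      arr y.2.1 i.1 * pol y.1 y.2.1 y.2.2 i.2.1 * PA y.2.1 i.2.2.1 * PD y.2.2 i.2.2.2 ≠ 0 →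
      Reach (nextState R y i) ∧ (∀ m, i.1 m ≤ N) ∧
        IsMaxScalarChoice R G feasible y.2.2 y.1 i.2.1 ∧
        countVec (nextState R y i).1 = countVec y.1 + countVec i.1 - netDeparture R i.2.1 := by
    rintro y ⟨t, ht⟩ i hi
    obtain ⟨h3, h4⟩ := hproc.exists_transition ht hi
    obtain ⟨ω, rfl, rfl, h5, h6, h7⟩ :=
      h4 _ ((hmax t).and ((hproc.evolution t).and (hproc.ae_nextState t)))
    refine ⟨⟨t + 1, h3⟩, hN (sA t ω) _ ?_, h5, ?_⟩
    · rw [PMF.mem_support_iff]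
      exact left_ne_zero_of_mul (left_ne_zero_of_mul (left_ne_zero_of_mul hi))
    · rw [← h7]
      ext m
      simpa [countVec, netDeparture] using h6 m
  have hWreach : ∀ y, Reach y → W y = ENNReal.ofReal (V y.1 y.2.1 y.2.2) := fun y hy => if_pos hy
  have hC : {y : St | Reach y ∧ ‖countVec y.1‖ < K}.Finite := by
    refine ((finite_norm_countVec_lt M K).prod (Set.finite_univ (α := SA × SD))).subset ?_
    exact fun y hy => ⟨hy.2, trivial⟩
  have hbound : ∀ t, ∑' y, ν t y * f y ≤
      ∑' y, ν 0 y * W y + ∑ y ∈ hC.toFinset, (T W y + f y) := by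
    refine expectation_le_of_drift T (transitionOp_mono R PA PD arr pol)
      (transitionOp_add R PA PD arr pol) ?_ (fun t φ => ∑' y, ν t y * φ y) ?_ ?_ ?_ ?_
      hC.toFinset f W ?_
    · funext y
      simp [T, transitionOp]
    · intro t φ ψ h
      exact ENNReal.tsum_le_tsum fun y => mul_le_mul_right (h y) _
    · intro t φ ψ
      simp only [Pi.add_apply, mul_add, ENNReal.tsum_add, le_refl]
    · intro t c
      rw [ENNReal.tsum_mul_right, hproc.tsum_state t, one_mul]
    · intro t φ
      exact (hproc.expectation_succ t φ).le
    · intro y hy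
      by_cases hyR : Reach y
      swap
      · simp [W, hyR]
      have hyK : K ≤ ‖countVec y.1‖ := by
        by_contra! h
        exact hy (hC.mem_toFinset.2 ⟨hyR, h⟩)
      obtain ⟨β, ψA, ψD, h3, h4⟩ := hdrift y.1 hyK y.2.1 y.2.2
      have hm1 : pmfMean (arr y.2.1) (fun a => ∑ m, grad G (countVec y.1) m * a m) =
          ∑ m, grad G (countVec y.1) m * arrivalMean arr y.2.1 m := by
        rw [pmfMean_finset_sum _ (hfin _)]
        exact Finset.sum_congr rfl fun m _ => pmfMean_const_mul _ _ _
      have hm2 : pmfMean (PD y.2.2) (fun e => ψD e + β) = pmfMean (PD y.2.2) ψD + β := by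
        rw [pmfMean_add _ (Set.toFinite _), pmfMean_const]
      have hle := fun i hi => h3 i.1 i.2.1 i.2.2.1 i.2.2.2 (nextState R y i).1
        (hstep y hyR i hi).2.1 (hstep y hyR i hi).2.2.1 (hstep y hyR i hi).2.2.2
      obtain ⟨h5, h6⟩ := tsum_four_pmf_le_ofReal (arr y.2.1) (hfin _) (pol y.1 y.2.1 y.2.2)
        (PA y.2.1) (Set.toFinite _) (PD y.2.2) (Set.toFinite _) (fun i => W (nextState R y i))
        (fun a => ∑ m, grad G (countVec y.1) m * a m) ψA (fun e => ψD e + β)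
        (fun i hi => (hV0 _ _ _).trans (hle i hi))
        (fun i hi => by
          rw [hWreach _ (hstep y hyR i hi).1]
          exact ENNReal.ofReal_le_ofReal (hle i hi))
      rw [hm1, hm2] at h5 h6
      refine (add_le_add_left h6 _).trans ?_
      rw [hWreach y hyR, ← ENNReal.ofReal_add h5 (by positivity)]
      exact ENNReal.ofReal_le_ofReal h4
  have hinit' : ∑' y, ν 0 y * W y ≠ ⊤ := by
    have h3 : ∑' y, ν 0 y * W y ≤
        ∑' y, ν 0 y * ENNReal.ofReal (2 * |G (countVec y.1)| + b) := by
      refine ENNReal.tsum_le_tsum fun y => ?_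
      by_cases hy : ν 0 y = 0
      · simp [hy]
      · rw [hWreach y ⟨0, hy⟩]
        exact mul_le_mul_right (ENNReal.ofReal_le_ofReal (hVle _ _ _)) _
    refine ne_top_of_le_ne_top ?_ h3
    have h4 := hproc.lintegral_state 0 fun y => ENNReal.ofReal (2 * |G (countVec y.1)| + b)
    rw [← h4]
    have h5 : Integrable (fun ω => 2 * |G (countVec (X 0 ω))| + b) μ :=
      (hinit.abs.const_mul 2).add (integrable_const b)
    exact (Integrable.lintegral_lt_top h5).ne
  -- From a reachable state all possible successors are reachable and within distance `r`, so they
  -- avoid the value `⊤` and the potential is bounded on them.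
  have hfinite : ∀ y ∈ hC.toFinset, T W y + f y ≠ ⊤ := by
    intro y hy
    have hyR := (hC.mem_toFinset.1 hy).1
    obtain ⟨b', -, hb'⟩ := exists_le_countVec (fun x : Fin M → ℕ => 2 * |G (countVec x)| + b)
      (‖countVec y.1‖ + r + 1)
    refine ENNReal.add_ne_top.2 ⟨ne_top_of_le_ne_top (b := ENNReal.ofReal b')
      ENNReal.ofReal_ne_top ?_, ENNReal.ofReal_ne_top⟩
    refine tsum_four_pmf_le (arr y.2.1) (pol y.1 y.2.1 y.2.2) (PA y.2.1) (PD y.2.2)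
      (fun i => W (nextState R y i)) _ fun i hi => ?_
    obtain ⟨h3, h4, h5, h6⟩ := hstep y hyR i hi
    rw [hWreach _ h3]
    refine ENNReal.ofReal_le_ofReal ((hVle _ _ _).trans (hb' _ ?_))
    have h7 := hr _ _ _ _ _ h4 h5 h6
    have h8 := norm_sub_norm_le (countVec (nextState R y i).1) (countVec y.1)
    linarith
  have hδ' : ENNReal.ofReal δ ≠ 0 := by simpa using hδ
  refine isFStable_of_le μ _ X
    ((∑' y, ν 0 y * W y + ∑ y ∈ hC.toFinset, (T W y + f y)) / ENNReal.ofReal δ)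
    (ENNReal.div_ne_top (ENNReal.add_ne_top.2 ⟨hinit', ENNReal.sum_ne_top.2 hfinite⟩) hδ')
    fun t => ?_
  rw [ENNReal.le_div_iff_mul_le (Or.inl hδ') (Or.inl ENNReal.ofReal_ne_top), mul_comm,
    ← lintegral_const_mul' _ _ ENNReal.ofReal_ne_top]
  refine le_trans (le_of_eq ?_) (hbound t)
  rw [← hproc.lintegral_state t f]
  simp only [f, ENNReal.ofReal_mul hδ.le]

end
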